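/- **Theorem (topological Furstenberg conjecture).** Let $G$ be a second-countable Hausdorff topological group. *Notation.* Let $\mathrm{RUCB}(G)$ be the unital $C^*$-algebra (pointwise operations, supremum norm) of all bounded functions $f\colon G\to\mathbb{C}$ such that for every $\varepsilon>0$ there is a neighbourhood $U$ of the neutral element with $|f(x)-f(y)|\le\varepsilon$ whenever $xy^{-1}\in U$. For $g\in G$ let $\lambda_g(x)=gx$. The group $G$ is *amenable* if there is a positive linear functional $m$ on $\mathrm{RUCB}(G)$ with $m(\mathbf 1)=1$ and $m(f\circ\lambda_g)=m(f)$ for all $f\in\mathrm{RUCB}(G)$, $g\in G$. For a Borel probability measure $\mu$ on $G$ and $f\in \mathrm{RUCB}(G)$ put $(\Phi_\mu f)(g)=\int f(gx)\,d\mu(x)$, let $\mu^n$ be the $n$-th convolution power of $\mu$, and let $\mathrm H_\mu(G)=\{f\in\mathrm{RUCB}(G) : \Phi_\mu f=f\}$. With the supremum norm, complex conjugation, and the multiplication $$(f_1\cdot_\mu f_2)(g)=\lim_{n\to\infty}\Phi_{\mu^n}(f_1f_2)(g),$$ $\mathrm H_\mu(G)$ is a commutative unital $C^*$-algebra. The *Poisson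 boundary* $\Pi_\mu(G)$ is its Gelfand spectrum, i.e. the compact Hausdorff space of (non-zero) ${}^*$-homomorphisms $\mathrm H_\mu(G)\to\mathbb C$ with the weak-$*$ topology; it is *trivial* if it is a singleton. The measure $\mu$ is *fully supported* if every non-empty open set has positive measure, and *regular* if $\mu(B)=\sup\{\mu(K) : K\subseteq B \text{ compact}\}$ for every Borel set $B$. *Statement.* The following are equivalent: 1. $G$ is amenable; 2. there is a fully supported, regular Borel probability measure $\mu$ on $G$ whose Poisson boundary $\Pi_\mu(G)$ is trivial; 3. there is a Borel probability measure $\mu$ on $G$ whose Poisson boundary $\Pi_\mu(G)$ is trivial. -/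

import Mathlib

open MeasureTheory Filter
open scoped Topology ComplexOrder BoundedContinuousFunction

namespace TopFurstenberg

section Amenability

variable {G : Type*} [Group G] [TopologicalSpace G]

/-- Right-uniform continuity of a complex-valued function on a topological group. -/
def IsRightUnifCont (f : G → ℂ) : Prop :=
  ∀ ε : ℝ, 0 < ε → ∃ U ∈ 𝓝 (1 : G), ∀ x y : G, x * y⁻¹ ∈ U → ‖f x - f y‖ ≤ ε

variable (G) in
/-- The unital C*-algebra of all right-uniformly continuous bounded complex-valued functions
on `G`, with pointwise operations and the supremum norm. (Right-uniformly continuous functions are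
continuous, so nothing is lost by cutting it out of the bounded continuous functions.) -/
def RUCB : StarSubalgebra ℂ (G →ᵇ ℂ) where
  carrier := {f | IsRightUnifCont f}
  mul_mem' := by
    intro f h hf hh ε hε
    obtain ⟨U, hU, hfU⟩ := hf (ε / (2 * (‖h‖ + 1))) (by positivity)
    obtain ⟨V, hV, hhV⟩ := hh (ε / (2 * (‖f‖ + 1))) (by positivity)
    refine ⟨U ∩ V, inter_mem hU hV, fun x y hxy => ?_⟩
    have h1 := hfU x y hxy.1
    have h2 := hhV x y hxy.2
    have h3 := f.norm_coe_le_norm x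
    have h4 := h.norm_coe_le_norm y
    have e : (f * h) x - (f * h) y = f x * (h x - h y) + (f x - f y) * h y := by
      simp only [BoundedContinuousFunction.mul_apply]; ring
    rw [e]
    calc ‖f x * (h x - h y) + (f x - f y) * h y‖
        ≤ ‖f x‖ * ‖h x - h y‖ + ‖f x - f y‖ * ‖h y‖ := by
          refine (norm_add_le _ _).trans ?_
          rw [norm_mul, norm_mul]
      _ ≤ (‖f‖ + 1) * (ε / (2 * (‖f‖ + 1))) + (ε / (2 * (‖h‖ + 1))) * (‖h‖ + 1) := by
          gcongr <;> linarith
      _ = ε := by field_simp; norm_num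
  add_mem' := by
    intro f h hf hh ε hε
    obtain ⟨U, hU, hfU⟩ := hf (ε / 2) (by positivity)
    obtain ⟨V, hV, hhV⟩ := hh (ε / 2) (by positivity)
    refine ⟨U ∩ V, inter_mem hU hV, fun x y hxy => ?_⟩
    have h1 := hfU x y hxy.1
    have h2 := hhV x y hxy.2
    have e : (f + h) x - (f + h) y = (f x - f y) + (h x - h y) := by
      simp only [BoundedContinuousFunction.add_apply]; ring
    rw [e]
    exact (norm_add_le _ _).trans (by linarith)
  algebraMap_mem' := by
    intro c ε hε
    refine ⟨Set.univ, univ_mem, fun x y _ => ?_⟩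
    simp [BoundedContinuousFunction.algebraMap_apply, hε.le]
  star_mem' := by
    intro f hf ε hε
    obtain ⟨U, hU, hfU⟩ := hf ε hε
    refine ⟨U, hU, fun x y hxy => ?_⟩
    have e : (star f) x - (star f) y = star (f x - f y) := by
      simp
    rw [e, norm_star]
    exact hfU x y hxy

theorem mem_RUCB {f : G →ᵇ ℂ} : f ∈ RUCB G ↔ IsRightUnifCont f := Iff.rfl

/-- The set `M(G)` of states of `RUCB G`: positive unital continuous linear functionals.
The positive elements of `RUCB G` are the functions with values in `[0, ∞)`. -/
def states (G : Type*) [Group G] [TopologicalSpace G] : Set (RUCB G →L[ℂ] ℂ) :=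
  {m | (∀ f : RUCB G, (∀ x, 0 ≤ (f : G →ᵇ ℂ) x) → 0 ≤ m f) ∧ m 1 = 1}

variable [IsTopologicalGroup G]

/-- The function `f ∘ λ_g : x ↦ f (g x)` on `G`, for `f ∈ RUCB G`. -/
noncomputable def leftTranslate (g : G) (f : RUCB G) : RUCB G :=
  ⟨(f : G →ᵇ ℂ).compContinuous ⟨fun x => g * x, continuous_const_mul g⟩, by
    intro ε hε
    obtain ⟨U, hU, hfU⟩ := f.2 ε hε
    have hc : Tendsto (fun u : G => g * u * g⁻¹) (𝓝 1) (𝓝 1) := by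
      have : Continuous (fun u : G => g * u * g⁻¹) := by fun_prop
      simpa using this.tendsto 1
    refine ⟨_, hc hU, fun x y hxy => ?_⟩
    apply hfU
    simpa [mul_assoc] using hxy⟩

@[simp] theorem leftTranslate_apply (g : G) (f : RUCB G) (x : G) :
    (leftTranslate g f : G →ᵇ ℂ) x = (f : G →ᵇ ℂ) (g * x) := rfl

variable (G) in
/-- Amenability of a topological group: some state of `RUCB G` is fixed by the action
`(g m)(f) = m (f ∘ λ_g)` of `G` on the states. -/
def IsAmenable : Prop :=
  ∃ m ∈ states G, ∀ (g : G) (f : RUCB G), m (leftTranslate g f) = m f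

end Amenability

section Poisson

set_option linter.unusedSectionVars false

variable {G : Type*} [Group G] [TopologicalSpace G] [MeasurableSpace G]

/-- The averaging operator `(Φ_μ f)(g) = ∫ f (g x) dμ(x)`. -/
noncomputable def Phi (μ : Measure G) (f : G → ℂ) : G → ℂ :=
  fun g => ∫ x, f (g * x) ∂μ

/-- The convolution powers of `μ`, with `μ⁰` the Dirac measure at the identity. -/
noncomputable def convPow (μ : Measure G) : ℕ → Measure G
  | 0 => Measure.dirac 1
  | n + 1 => μ ∗ₘ convPow μ n

/-- `Phi` does not increase moduli of right-uniform continuity. -/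
theorem Phi_sub_le [IsTopologicalGroup G] [BorelSpace G] (μ : Measure G) [IsProbabilityMeasure μ]
    {f : G → ℂ} (hc : Continuous f) {C : ℝ} (hC : ∀ x, ‖f x‖ ≤ C) {U : Set G} {ε : ℝ}
    (hU : ∀ x y : G, x * y⁻¹ ∈ U → ‖f x - f y‖ ≤ ε) (x y : G) (hxy : x * y⁻¹ ∈ U) :
    ‖Phi μ f x - Phi μ f y‖ ≤ ε := by
  have hi : ∀ g : G, Integrable (fun z => f (g * z)) μ := fun g =>
    Integrable.of_bound (hc.comp (continuous_const_mul g)).aestronglyMeasurable C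
      (Eventually.of_forall fun z => hC _)
  unfold Phi
  rw [← integral_sub (hi x) (hi y)]
  refine (norm_integral_le_of_norm_le_const (C := ε) (Eventually.of_forall fun z => ?_)).trans
    (by simp)
  apply hU
  simpa [mul_assoc] using hxy

theorem Phi_norm_le (μ : Measure G) [IsProbabilityMeasure μ]
    {f : G → ℂ} {C : ℝ} (hC : ∀ x, ‖f x‖ ≤ C) (g : G) : ‖Phi μ f g‖ ≤ C := by
  unfold Phi
  exact (norm_integral_le_of_norm_le_const (C := C) (Eventually.of_forall fun z => hC _)).trans
    (by simp)

theorem IsRightUnifCont.continuous [IsTopologicalGroup G] {f : G → ℂ} (hf : IsRightUnifCont f) :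
    Continuous f := by
  rw [continuous_iff_continuousAt]
  intro y
  rw [ContinuousAt, Metric.tendsto_nhds]
  intro ε hε
  obtain ⟨U, hU, h⟩ := hf (ε / 2) (by positivity)
  have hc : Tendsto (fun x : G => x * y⁻¹) (𝓝 y) (𝓝 1) := by
    have : Continuous (fun x : G => x * y⁻¹) := by fun_prop
    simpa using this.tendsto y
  filter_upwards [hc hU] with x hx
  rw [dist_eq_norm]
  exact (h x y hx).trans_lt (by linarith)

theorem Phi_mul_integrable [IsTopologicalGroup G] [BorelSpace G] (μ : Measure G)
    [IsProbabilityMeasure μ] (f : G →ᵇ ℂ) (g : G) : Integrable (fun z => f (g * z)) μ :=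
  Integrable.of_bound (f.continuous.comp (continuous_const_mul g)).aestronglyMeasurable ‖f‖
      (Eventually.of_forall fun _ => f.norm_coe_le_norm _)

theorem Phi_add [IsTopologicalGroup G] [BorelSpace G] (μ : Measure G) [IsProbabilityMeasure μ]
    (f h : G →ᵇ ℂ) (g : G) : Phi μ (f + h : G →ᵇ ℂ) g = Phi μ f g + Phi μ h g :=
  integral_add (Phi_mul_integrable μ f g) (Phi_mul_integrable μ h g)

theorem Phi_smul (μ : Measure G) (c : ℂ) (f : G →ᵇ ℂ) (g : G) :
    Phi μ (c • f : G →ᵇ ℂ) g = c * Phi μ f g :=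
  integral_const_mul c _

theorem Phi_sub [IsTopologicalGroup G] [BorelSpace G] (μ : Measure G) [IsProbabilityMeasure μ]
    (f h : G →ᵇ ℂ) (g : G) : Phi μ (f - h : G →ᵇ ℂ) g = Phi μ f g - Phi μ h g :=
  integral_sub (Phi_mul_integrable μ f g) (Phi_mul_integrable μ h g)

theorem Phi_star (μ : Measure G) (f : G →ᵇ ℂ) (g : G) :
    Phi μ (star f : G →ᵇ ℂ) g = star (Phi μ f g) :=
  integral_conj

theorem Phi_re_mono [IsTopologicalGroup G] [BorelSpace G] (μ : Measure G) [IsProbabilityMeasure μ]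
    (f h : G →ᵇ ℂ) (hfh : ∀ x, (f x).re ≤ (h x).re) (g : G) :
    (Phi μ f g).re ≤ (Phi μ h g).re := by
  have e : ∀ k : G →ᵇ ℂ, (Phi μ k g).re = ∫ x, (k (g * x)).re ∂μ := fun k =>
    (integral_re (Phi_mul_integrable μ k g)).symm
  rw [e, e]
  exact integral_mono (Phi_mul_integrable μ f g).re (Phi_mul_integrable μ h g).re fun x => hfh _

variable [IsTopologicalGroup G] [SecondCountableTopology G] [BorelSpace G]

instance (μ : Measure G) [IsProbabilityMeasure μ] (n : ℕ) :
    IsProbabilityMeasure (convPow μ n) := by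
  induction n with
  | zero => unfold convPow; infer_instance
  | succ n ih => unfold convPow; infer_instance

theorem Phi_zero (μ : Measure G) (f : G →ᵇ ℂ) (g : G) : Phi (convPow μ 0) f g = f g := by
  have h : StronglyMeasurable (fun z => f (g * z)) :=
    (f.continuous.comp (continuous_const_mul g)).stronglyMeasurable
  unfold Phi convPow
  rw [integral_dirac' _ _ h, mul_one]

theorem Phi_succ (μ : Measure G) [IsProbabilityMeasure μ] (n : ℕ) (f : G →ᵇ ℂ) (g : G) :
    Phi (convPow μ (n + 1)) f g = Phi μ (Phi (convPow μ n) f) g := by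
  unfold Phi
  rw [convPow, integral_mconv (Phi_mul_integrable (μ ∗ₘ convPow μ n) f g)]
  simp only [mul_assoc]

/-- Pointwise convergence of the sequence `Φ_{μⁿ} f` to `k`. -/
def HasBoundaryLimit (μ : Measure G) (f k : G → ℂ) : Prop :=
  ∀ g, Tendsto (fun n => Phi (convPow μ n) f g) atTop (𝓝 (k g))

variable {μ : Measure G} [IsProbabilityMeasure μ]

variable (μ) in
/-- The space `H_μ(G)` of `μ`-harmonic functions: all `f` in `RUCB G` with `Φ_μ f = f`. -/
def harmonicSubmodule : Submodule ℂ (G →ᵇ ℂ) where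
  carrier := {f | f ∈ RUCB G ∧ Phi μ f = f}
  add_mem' := by
    rintro f h ⟨hf, hf'⟩ ⟨hh, hh'⟩
    refine ⟨add_mem hf hh, funext fun g => ?_⟩
    rw [Phi_add, hf', hh']; rfl
  zero_mem' := ⟨zero_mem _, funext fun g => by simp [Phi]⟩
  smul_mem' := by
    rintro c f ⟨hf, hf'⟩
    refine ⟨SMulMemClass.smul_mem c hf, funext fun g => ?_⟩
    rw [Phi_smul, hf']; rfl

variable (μ) in
/-- The type of `μ`-harmonic functions, with the supremum norm. -/
def HarmonicFunction : Type _ := harmonicSubmodule μ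

noncomputable instance : NormedAddCommGroup (HarmonicFunction μ) :=
  inferInstanceAs (NormedAddCommGroup (harmonicSubmodule μ))

noncomputable instance : NormedSpace ℂ (HarmonicFunction μ) :=
  inferInstanceAs (NormedSpace ℂ (harmonicSubmodule μ))

namespace HarmonicFunction

/-- The underlying bounded continuous function. -/
def toBCF (h : HarmonicFunction μ) : G →ᵇ ℂ := h.1

theorem toBCF_mem (h : HarmonicFunction μ) : h.toBCF ∈ RUCB G := h.2.1

theorem Phi_eq (h : HarmonicFunction μ) : Phi μ h.toBCF = h.toBCF := h.2.2

theorem ext' {h k : HarmonicFunction μ} (e : ∀ g, h.toBCF g = k.toBCF g) : h = k :=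
  Subtype.ext (BoundedContinuousFunction.ext e)

theorem norm_def (h : HarmonicFunction μ) : ‖h‖ = ‖h.toBCF‖ := rfl

@[simp] theorem toBCF_add (h k : HarmonicFunction μ) : (h + k).toBCF = h.toBCF + k.toBCF := rfl
@[simp] theorem toBCF_sub (h k : HarmonicFunction μ) : (h - k).toBCF = h.toBCF - k.toBCF := rfl
@[simp] theorem toBCF_smul (c : ℂ) (h : HarmonicFunction μ) : (c • h).toBCF = c • h.toBCF := rfl
@[simp] theorem toBCF_zero : (0 : HarmonicFunction μ).toBCF = 0 := rfl

end HarmonicFunction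

open HarmonicFunction

/-- A pointwise limit of `Φ_{μⁿ} f` is bounded by the norm of `f`. -/
theorem HasBoundaryLimit.norm_le {f : G →ᵇ ℂ} {k : G → ℂ} (h : HasBoundaryLimit μ f k) (g : G) :
    ‖k g‖ ≤ ‖f‖ :=
  le_of_tendsto (h g).norm (Eventually.of_forall fun n =>
    Phi_norm_le (convPow μ n) f.norm_coe_le_norm g)

/-- A pointwise limit of `Φ_{μⁿ} f` is right-uniformly continuous. -/
theorem HasBoundaryLimit.isRightUnifCont {f : G →ᵇ ℂ} (hf : f ∈ RUCB G) {k : G → ℂ}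
    (h : HasBoundaryLimit μ f k) : IsRightUnifCont k := by
  intro ε hε
  obtain ⟨U, hU, hfU⟩ := hf ε hε
  refine ⟨U, hU, fun x y hxy => ?_⟩
  exact le_of_tendsto ((h x).sub (h y)).norm (Eventually.of_forall fun n =>
    Phi_sub_le (convPow μ n) f.continuous f.norm_coe_le_norm hfU x y hxy)

/-- A pointwise limit of `Φ_{μⁿ} f` is fixed by `Φ_μ`. -/
theorem HasBoundaryLimit.Phi_eq {f : G →ᵇ ℂ} (hf : f ∈ RUCB G) {k : G → ℂ}
    (h : HasBoundaryLimit μ f k) : Phi μ k = k := by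
  funext g
  have h1 : Tendsto (fun n => Phi (convPow μ (n + 1)) f g) atTop (𝓝 (k g)) :=
    (h g).comp (tendsto_add_atTop_nat 1)
  have hcont : ∀ n, Continuous (Phi (convPow μ n) f) := fun n => by
    apply IsRightUnifCont.continuous
    intro ε hε
    obtain ⟨U, hU, hfU⟩ := hf ε hε
    exact ⟨U, hU, Phi_sub_le (convPow μ n) f.continuous f.norm_coe_le_norm hfU⟩
  have h2 : Tendsto (fun n => Phi (convPow μ (n + 1)) f g) atTop (𝓝 (Phi μ k g)) := by
    simp only [Phi_succ]
    exact tendsto_integral_of_dominated_convergence (fun _ => ‖f‖)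
      (fun n => ((hcont n).comp (continuous_const_mul g)).aestronglyMeasurable)
      (integrable_const _)
      (fun n => Eventually.of_forall fun x => Phi_norm_le _ f.norm_coe_le_norm _)
      (Eventually.of_forall fun x => h _)
  exact tendsto_nhds_unique h2 h1

/-- The harmonic function obtained as the pointwise limit of `Φ_{μⁿ} f`. -/
noncomputable def HasBoundaryLimit.toHarmonic {f : G →ᵇ ℂ} (hf : f ∈ RUCB G) {k : G → ℂ}
    (h : HasBoundaryLimit μ f k) : HarmonicFunction μ :=
  ⟨BoundedContinuousFunction.ofNormedAddCommGroup k (h.isRightUnifCont hf).continuous ‖f‖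
    h.norm_le, h.isRightUnifCont hf, h.Phi_eq hf⟩

theorem HasBoundaryLimit.unique {f k k' : G → ℂ} (h : HasBoundaryLimit μ f k)
    (h' : HasBoundaryLimit μ f k') : k = k' :=
  funext fun g => tendsto_nhds_unique (h g) (h' g)

theorem HasBoundaryLimit.add {f f' : G →ᵇ ℂ} {k k' : G → ℂ} (h : HasBoundaryLimit μ f k)
    (h' : HasBoundaryLimit μ f' k') : HasBoundaryLimit μ (f + f' : G →ᵇ ℂ) (k + k') := fun g => by
  simp only [Phi_add]; exact (h g).add (h' g)

theorem HasBoundaryLimit.sub {f f' : G →ᵇ ℂ} {k k' : G → ℂ} (h : HasBoundaryLimit μ f k)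
    (h' : HasBoundaryLimit μ f' k') : HasBoundaryLimit μ (f - f' : G →ᵇ ℂ) (k - k') := fun g => by
  simp only [Phi_sub]; exact (h g).sub (h' g)

theorem HasBoundaryLimit.smul (c : ℂ) {f : G →ᵇ ℂ} {k : G → ℂ} (h : HasBoundaryLimit μ f k) :
    HasBoundaryLimit μ (c • f : G →ᵇ ℂ) (c • k) := fun g => by
  simp only [Phi_smul]; exact (h g).const_mul c

theorem HasBoundaryLimit.star {f : G →ᵇ ℂ} {k : G → ℂ} (h : HasBoundaryLimit μ f k) :
    HasBoundaryLimit μ (star f : G →ᵇ ℂ) (star k) := fun g => by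
  simp only [Phi_star]; exact (h g).star

theorem HarmonicFunction.Phi_pow_eq (h : HarmonicFunction μ) (n : ℕ) :
    Phi (convPow μ n) h.toBCF = h.toBCF := by
  induction n with
  | zero => exact funext fun g => Phi_zero μ _ g
  | succ n ih => exact funext fun g => by rw [Phi_succ, ih, h.Phi_eq]

theorem HarmonicFunction.hasBoundaryLimit (h : HarmonicFunction μ) :
    HasBoundaryLimit μ h.toBCF h.toBCF := fun g => by
  simp only [h.Phi_pow_eq]; exact tendsto_const_nhds

/-- Cauchy-Schwarz: `|h|² ≤ Φ_μ (|h|²)` for harmonic `h`. -/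
theorem HarmonicFunction.sq_le (h : HarmonicFunction μ) (g : G) :
    ‖h.toBCF g‖ ^ 2 ≤ (Phi μ (star h.toBCF * h.toBCF : G →ᵇ ℂ) g).re := by
  have hi := Phi_mul_integrable μ h.toBCF g
  have e : (Phi μ (star h.toBCF * h.toBCF : G →ᵇ ℂ) g).re
      = ∫ x, ‖h.toBCF (g * x)‖ ^ 2 ∂μ := by
    rw [show (Phi μ (star h.toBCF * h.toBCF : G →ᵇ ℂ) g).re
      = ∫ x, ((star h.toBCF * h.toBCF : G →ᵇ ℂ) (g * x)).re ∂μ from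
        (integral_re (Phi_mul_integrable μ (star h.toBCF * h.toBCF) g)).symm]
    refine integral_congr_ae (Eventually.of_forall fun x => ?_)
    simp [Complex.sq_norm, Complex.normSq_apply]
  have h0 : ‖h.toBCF g‖ ≤ ∫ x, ‖h.toBCF (g * x)‖ ∂μ := by
    conv_lhs => rw [← h.Phi_eq]
    exact norm_integral_le_integral_norm _
  have hsq : Integrable (fun x => ‖h.toBCF (g * x)‖ ^ 2) μ := by
    refine Integrable.of_bound
      ((h.toBCF.continuous.comp (continuous_const_mul g)).norm.pow 2).aestronglyMeasurable
      (‖h.toBCF‖ ^ 2) (Eventually.of_forall fun x => ?_)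
    simp only [norm_pow, norm_norm]
    gcongr
    exact h.toBCF.norm_coe_le_norm _
  set c := ∫ x, ‖h.toBCF (g * x)‖ ∂μ
  have h1 : 0 ≤ ∫ x, (‖h.toBCF (g * x)‖ - c) ^ 2 ∂μ := integral_nonneg fun x => sq_nonneg _
  have h2 : ∫ x, (‖h.toBCF (g * x)‖ - c) ^ 2 ∂μ
      = (∫ x, ‖h.toBCF (g * x)‖ ^ 2 ∂μ) - c ^ 2 := by
    have : ∀ x, (‖h.toBCF (g * x)‖ - c) ^ 2
        = ‖h.toBCF (g * x)‖ ^ 2 - 2 * c * ‖h.toBCF (g * x)‖ + c ^ 2 := fun x => by ring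
    simp only [this]
    have hl : Integrable (fun x => 2 * c * ‖h.toBCF (g * x)‖) μ := hi.norm.const_mul _
    have hs : Integrable (fun x => ‖h.toBCF (g * x)‖ ^ 2 - 2 * c * ‖h.toBCF (g * x)‖) μ :=
      hsq.sub hl
    rw [integral_add hs (integrable_const _), integral_sub hsq hl, integral_const_mul]
    simp only [integral_const, probReal_univ, one_smul]
    change _ - 2 * c * c + c ^ 2 = _
    ring
  have h3 : 0 ≤ ‖h.toBCF g‖ := norm_nonneg _
  rw [e]
  nlinarith

/-- The sequence `Φ_{μⁿ} (|h|²)` converges pointwise, from below. -/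
theorem HarmonicFunction.exists_limit_sq (h : HarmonicFunction μ) :
    ∃ k : G → ℂ, HasBoundaryLimit μ (star h.toBCF * h.toBCF : G →ᵇ ℂ) k ∧
      ∀ g, ‖h.toBCF g‖ ^ 2 ≤ (k g).re ∧ (k g).im = 0 := by
  set F : G →ᵇ ℂ := star h.toBCF * h.toBCF with hF
  have hFr : ∀ x, F x = ((‖h.toBCF x‖ ^ 2 : ℝ) : ℂ) := fun x => by
    have := Complex.conj_mul' (h.toBCF x)
    simpa [hF] using this
  have him : ∀ n g, (Phi (convPow μ n) F g).im = 0 := fun n g => by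
    unfold Phi
    simp only [hFr]
    rw [integral_complex_ofReal]
    exact Complex.ofReal_im _
  have hcont : ∀ n, Continuous (Phi (convPow μ n) F) := fun n => by
    apply IsRightUnifCont.continuous
    intro ε hε
    obtain ⟨U, hU, hfU⟩ :=
      (mul_mem (star_mem h.toBCF_mem) h.toBCF_mem : F ∈ RUCB G) ε hε
    exact ⟨U, hU, Phi_sub_le (convPow μ n) F.continuous F.norm_coe_le_norm hfU⟩
  let B : ℕ → G →ᵇ ℂ := fun n => BoundedContinuousFunction.ofNormedAddCommGroup
    (Phi (convPow μ n) F) (hcont n) ‖F‖ (Phi_norm_le _ F.norm_coe_le_norm)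
  have hstep : ∀ n g, (Phi (convPow μ n) F g).re ≤ (Phi (convPow μ (n + 1)) F g).re := by
    intro n
    induction n with
    | zero =>
      intro g
      rw [Phi_succ, Phi_zero, hFr, Complex.ofReal_re,
        show Phi (convPow μ 0) F = F from funext (Phi_zero μ F)]
      exact h.sq_le g
    | succ n ih =>
      intro g
      rw [Phi_succ, Phi_succ μ (n + 1)]
      exact Phi_re_mono μ (B n) (B (n + 1)) ih g
  have hmono : ∀ g, Monotone fun n => (Phi (convPow μ n) F g).re :=
    fun g => monotone_nat_of_le_succ fun n => hstep n g
  have hbdd : ∀ g, BddAbove (Set.range fun n => (Phi (convPow μ n) F g).re) := fun g => by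
    refine ⟨‖F‖, ?_⟩
    rintro _ ⟨n, rfl⟩
    exact (Complex.re_le_norm _).trans (Phi_norm_le _ F.norm_coe_le_norm g)
  refine ⟨fun g => ((⨆ n, (Phi (convPow μ n) F g).re : ℝ) : ℂ), fun g => ?_, fun g => ⟨?_, ?_⟩⟩
  · have h1 := (Complex.continuous_ofReal.tendsto _).comp
      (tendsto_atTop_ciSup (hmono g) (hbdd g))
    refine h1.congr fun n => ?_
    exact Complex.ext (by simp) (by simp [him])
  · rw [Complex.ofReal_re]
    refine le_trans (le_of_eq ?_) (le_ciSup (hbdd g) 0)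
    simp only [Phi_zero, hFr, Complex.ofReal_re]
  · exact Complex.ofReal_im _

noncomputable instance : Star (HarmonicFunction μ) :=
  ⟨fun h => ⟨star h.toBCF, star_mem h.toBCF_mem, funext fun g => by
    rw [Phi_star, h.Phi_eq]; rfl⟩⟩

@[simp] theorem HarmonicFunction.toBCF_star (h : HarmonicFunction μ) :
    (star h).toBCF = star h.toBCF := rfl

theorem HarmonicFunction.polarization (h₁ h₂ : G →ᵇ ℂ) :
    h₁ * h₂ = (1 / 4 : ℂ) • (star (star h₁ + h₂) * (star h₁ + h₂)
      - star (star h₁ - h₂) * (star h₁ - h₂))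
      + (Complex.I / 4) • (star (star h₁ - Complex.I • h₂) * (star h₁ - Complex.I • h₂)
      - star (star h₁ + Complex.I • h₂) * (star h₁ + Complex.I • h₂)) := by
  ext g
  simp
  ring_nf
  simp [Complex.I_sq]
  ring

/-- The product `h₁ h₂` of two harmonic functions has a boundary limit, and modulo
functions with boundary limit zero it can be replaced by it. -/
theorem HarmonicFunction.exists_limit_mul (h₁ h₂ : HarmonicFunction μ) :
    ∃ k : G →ᵇ ℂ, HasBoundaryLimit μ (h₁.toBCF * h₂.toBCF : G →ᵇ ℂ) k ∧
      ∀ f : G →ᵇ ℂ, HasBoundaryLimit μ ((h₁.toBCF * h₂.toBCF - k) * f : G →ᵇ ℂ) 0 := by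
  have key : ∀ h : HarmonicFunction μ, ∃ k : G →ᵇ ℂ,
      HasBoundaryLimit μ (star h.toBCF * h.toBCF : G →ᵇ ℂ) k ∧
      ∀ f : G →ᵇ ℂ, HasBoundaryLimit μ ((star h.toBCF * h.toBCF - k) * f : G →ᵇ ℂ) 0 := by
    intro h
    obtain ⟨k, hk, hk'⟩ := h.exists_limit_sq
    have hF := mul_mem (star_mem h.toBCF_mem) h.toBCF_mem
    set F : G →ᵇ ℂ := star h.toBCF * h.toBCF with hF'
    set K : HarmonicFunction μ := hk.toHarmonic hF with hK
    have hKk : ∀ g, K.toBCF g = k g := fun g => rfl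
    refine ⟨K.toBCF, hk, fun f g => ?_⟩
    have hFr : ∀ x, F x = ((‖h.toBCF x‖ ^ 2 : ℝ) : ℂ) := fun x => by
      have := Complex.conj_mul' (h.toBCF x)
      simpa [hF'] using this
    have hp : ∀ x, ‖(F - K.toBCF) x‖ = ((K.toBCF - F) x).re := fun x => by
      have e : (F - K.toBCF) x = ((‖h.toBCF x‖ ^ 2 - (k x).re : ℝ) : ℂ) := by
        apply Complex.ext
        · simp [hFr, hKk]
        · simp [hFr, hKk, (hk' x).2]
      rw [e, Complex.norm_real, Real.norm_eq_abs, abs_of_nonpos (by linarith [(hk' x).1])]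
      rw [BoundedContinuousFunction.sub_apply, hKk, hFr, Complex.sub_re, Complex.ofReal_re]
      ring
    have h0 : HasBoundaryLimit μ (K.toBCF - F : G →ᵇ ℂ) 0 := by
      have := K.hasBoundaryLimit.sub hk
      rwa [show (⇑K.toBCF - k) = 0 from funext fun g => by simp [hKk]] at this
    have h1 : Tendsto (fun n => ‖f‖ * (Phi (convPow μ n) (K.toBCF - F : G →ᵇ ℂ) g).re)
        atTop (𝓝 0) := by
      have := ((Complex.continuous_re.tendsto _).comp (h0 g)).const_mul ‖f‖
      simpa using this
    refine squeeze_zero_norm (fun n => ?_) h1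
    have e : (Phi (convPow μ n) (K.toBCF - F : G →ᵇ ℂ) g).re
        = ∫ x, ((K.toBCF - F : G →ᵇ ℂ) (g * x)).re ∂(convPow μ n) :=
      (integral_re (Phi_mul_integrable (convPow μ n) (K.toBCF - F) g)).symm
    rw [e, ← integral_const_mul]
    refine norm_integral_le_of_norm_le
      ((Phi_mul_integrable (convPow μ n) (K.toBCF - F) g).re.const_mul _)
      (Eventually.of_forall fun x => ?_)
    rw [BoundedContinuousFunction.mul_apply, norm_mul, hp, mul_comm]
    gcongr
    · rw [← hp]; exact norm_nonneg _
    · exact f.norm_coe_le_norm _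
  obtain ⟨k₁, a₁, b₁⟩ := key (star h₁ + h₂)
  obtain ⟨k₂, a₂, b₂⟩ := key (star h₁ - h₂)
  obtain ⟨k₃, a₃, b₃⟩ := key (star h₁ - Complex.I • h₂)
  obtain ⟨k₄, a₄, b₄⟩ := key (star h₁ + Complex.I • h₂)
  simp only [toBCF_add, toBCF_sub, toBCF_star, toBCF_smul]
    at a₁ b₁ a₂ b₂ a₃ b₃ a₄ b₄
  refine ⟨(1 / 4 : ℂ) • (k₁ - k₂) + (Complex.I / 4) • (k₃ - k₄), ?_, fun f => ?_⟩
  · rw [polarization h₁.toBCF h₂.toBCF]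
    exact ((a₁.sub a₂).smul _).add ((a₃.sub a₄).smul _)
  · have := (((b₁ f).sub (b₂ f)).smul (1 / 4 : ℂ)).add
      (((b₃ f).sub (b₄ f)).smul (Complex.I / 4))
    simp only [sub_zero, smul_zero, add_zero] at this
    rw [polarization h₁.toBCF h₂.toBCF]
    convert this using 2
    ext g
    simp only [BoundedContinuousFunction.mul_apply, BoundedContinuousFunction.add_apply,
      BoundedContinuousFunction.sub_apply, BoundedContinuousFunction.smul_apply, smul_eq_mul]
    ring

/-- The pointwise limit `g ↦ lim_n Φ_{μⁿ}(h₁ h₂)(g)`. -/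
noncomputable def boundaryMul (h₁ h₂ : HarmonicFunction μ) : G → ℂ :=
  fun g => limUnder atTop fun n => Phi (convPow μ n) (h₁.toBCF * h₂.toBCF : G →ᵇ ℂ) g

theorem hasBoundaryLimit_mul (h₁ h₂ : HarmonicFunction μ) :
    HasBoundaryLimit μ (h₁.toBCF * h₂.toBCF : G →ᵇ ℂ) (boundaryMul h₁ h₂) := fun g => by
  obtain ⟨k, hk, -⟩ := h₁.exists_limit_mul h₂
  exact tendsto_nhds_limUnder ⟨_, hk g⟩

/-- The multiplication `(h₁ ·_μ h₂)(g) = lim_n Φ_{μⁿ}(h₁ h₂)(g)` of harmonic functions. -/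
noncomputable instance : Mul (HarmonicFunction μ) :=
  ⟨fun h₁ h₂ => (hasBoundaryLimit_mul h₁ h₂).toHarmonic (mul_mem h₁.toBCF_mem h₂.toBCF_mem)⟩

noncomputable instance : One (HarmonicFunction μ) :=
  ⟨⟨1, one_mem (RUCB G), funext fun g => by simp [Phi]⟩⟩

namespace HarmonicFunction

@[simp] theorem toBCF_one : (1 : HarmonicFunction μ).toBCF = 1 := rfl

theorem mul_apply (h₁ h₂ : HarmonicFunction μ) (g : G) : (h₁ * h₂).toBCF g =
    limUnder atTop fun n => Phi (convPow μ n) (h₁.toBCF * h₂.toBCF : G →ᵇ ℂ) g := rfl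

theorem mul_limit (h₁ h₂ : HarmonicFunction μ) :
    HasBoundaryLimit μ (h₁.toBCF * h₂.toBCF : G →ᵇ ℂ) (h₁ * h₂).toBCF :=
  hasBoundaryLimit_mul h₁ h₂

theorem eq_mul {h₁ h₂ k : HarmonicFunction μ}
    (h : HasBoundaryLimit μ (h₁.toBCF * h₂.toBCF : G →ᵇ ℂ) k.toBCF) : h₁ * h₂ = k :=
  ext' fun g => congrFun ((mul_limit h₁ h₂).unique h) g

theorem mul_limit_zero (h₁ h₂ : HarmonicFunction μ) (f : G →ᵇ ℂ) :
    HasBoundaryLimit μ ((h₁.toBCF * h₂.toBCF - (h₁ * h₂).toBCF) * f : G →ᵇ ℂ) 0 := by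
  obtain ⟨k, hk, hk'⟩ := h₁.exists_limit_mul h₂
  rw [show (h₁ * h₂).toBCF = k from
    BoundedContinuousFunction.ext fun g => congrFun ((mul_limit h₁ h₂).unique hk) g]
  exact hk' f

protected theorem mul_comm (h₁ h₂ : HarmonicFunction μ) : h₁ * h₂ = h₂ * h₁ :=
  eq_mul (by rw [mul_comm]; exact mul_limit h₂ h₁)

protected theorem one_mul (h : HarmonicFunction μ) : 1 * h = h :=
  eq_mul (by rw [toBCF_one, one_mul]; exact h.hasBoundaryLimit)

protected theorem mul_add (h k l : HarmonicFunction μ) : h * (k + l) = h * k + h * l :=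
  eq_mul (by rw [toBCF_add, mul_add]; exact (mul_limit h k).add (mul_limit h l))

protected theorem mul_smul (c : ℂ) (h k : HarmonicFunction μ) : h * (c • k) = c • (h * k) :=
  eq_mul (by rw [toBCF_smul, mul_smul_comm]; exact (mul_limit h k).smul c)

protected theorem mul_assoc (h k l : HarmonicFunction μ) : h * k * l = h * (k * l) := by
  have a : HasBoundaryLimit μ (h.toBCF * k.toBCF * l.toBCF : G →ᵇ ℂ) (h * k * l).toBCF := by
    have := (mul_limit_zero h k l.toBCF).add (mul_limit (h * k) l)
    rwa [← add_mul, sub_add_cancel, zero_add] at this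
  have b : HasBoundaryLimit μ (h.toBCF * k.toBCF * l.toBCF : G →ᵇ ℂ) (h * (k * l)).toBCF := by
    have := (mul_limit_zero k l h.toBCF).add (mul_limit (k * l) h)
    rw [← add_mul, sub_add_cancel, zero_add, HarmonicFunction.mul_comm] at this
    rwa [show h.toBCF * k.toBCF * l.toBCF = k.toBCF * l.toBCF * h.toBCF by ring]
  exact ext' fun g => congrFun (a.unique b) g

protected theorem star_mul (h k : HarmonicFunction μ) : star (h * k) = star h * star k :=
  (eq_mul (by
    rw [toBCF_star, toBCF_star, toBCF_star, ← star_mul']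
    exact (mul_limit h k).star)).symm

protected theorem norm_mul_le (h k : HarmonicFunction μ) : ‖h * k‖ ≤ ‖h‖ * ‖k‖ := by
  rw [norm_def, norm_def, norm_def]
  refine ((h * k).toBCF.norm_le (by positivity)).2 fun g => ?_
  exact ((mul_limit h k).norm_le g).trans (norm_mul_le _ _)

protected theorem norm_sq_le (h : HarmonicFunction μ) : ‖h‖ * ‖h‖ ≤ ‖star h * h‖ := by
  obtain ⟨k, hk, hk'⟩ := h.exists_limit_sq
  have e : ∀ g, (star h * h).toBCF g = k g := fun g =>
    congrFun ((mul_limit (star h) h).unique hk) g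
  have h1 : ∀ g, ‖h.toBCF g‖ ≤ Real.sqrt ‖star h * h‖ := fun g => by
    apply Real.le_sqrt_of_sq_le
    refine (hk' g).1.trans ((Complex.re_le_norm _).trans ?_)
    rw [← e]
    exact (star h * h).toBCF.norm_coe_le_norm g
  have h2 : ‖h‖ ≤ Real.sqrt ‖star h * h‖ :=
    (h.toBCF.norm_le (Real.sqrt_nonneg _)).2 h1
  calc ‖h‖ * ‖h‖ ≤ Real.sqrt ‖star h * h‖ * Real.sqrt ‖star h * h‖ := by gcongr
    _ = ‖star h * h‖ := Real.mul_self_sqrt (norm_nonneg _)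

end HarmonicFunction

theorem isClosed_harmonicSubmodule : IsClosed (harmonicSubmodule μ : Set (G →ᵇ ℂ)) := by
  refine isClosed_of_closure_subset fun f hf => ?_
  rw [Metric.mem_closure_iff] at hf
  refine ⟨fun ε hε => ?_, funext fun g => ?_⟩
  · obtain ⟨h, hh, hd⟩ := hf (ε / 3) (by positivity)
    obtain ⟨U, hU, hhU⟩ := hh.1 (ε / 3) (by positivity)
    refine ⟨U, hU, fun x y hxy => ?_⟩
    have h1 := hhU x y hxy
    have h2 := (f.dist_coe_le_dist (g := h) x).trans hd.le
    have h3 := (f.dist_coe_le_dist (g := h) y).trans hd.le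
    rw [dist_eq_norm] at h2 h3
    rw [show f x - f y = (f x - h x) + (h x - h y) - (f y - h y) by ring]
    refine (norm_sub_le _ _).trans ?_
    have := norm_add_le (f x - h x) (h x - h y)
    linarith
  · refine eq_of_forall_dist_le fun ε hε => ?_
    obtain ⟨h, hh, hd⟩ := hf (ε / 2) (by positivity)
    have h2 := (f.dist_coe_le_dist (g := h) g).trans hd.le
    have h1 : ‖Phi μ (f - h : G →ᵇ ℂ) g‖ ≤ ε / 2 :=
      Phi_norm_le μ (fun x => ((f - h).norm_coe_le_norm x).trans
        (by rw [← dist_eq_norm]; exact hd.le)) g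
    rw [Phi_sub, hh.2] at h1
    rw [dist_eq_norm] at h2 ⊢
    rw [show Phi μ f g - f g = (Phi μ f g - h g) - (f g - h g) by ring]
    exact (norm_sub_le _ _).trans (by linarith)

noncomputable instance : NormedCommRing (HarmonicFunction μ) where
  __ := (inferInstance : NormedAddCommGroup (HarmonicFunction μ))
  mul_assoc := HarmonicFunction.mul_assoc
  mul_comm := HarmonicFunction.mul_comm
  one_mul := HarmonicFunction.one_mul
  mul_one h := (HarmonicFunction.mul_comm h 1).trans (HarmonicFunction.one_mul h)
  left_distrib := HarmonicFunction.mul_add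
  right_distrib h k l := by
    rw [HarmonicFunction.mul_comm, HarmonicFunction.mul_add, HarmonicFunction.mul_comm l h,
      HarmonicFunction.mul_comm l k]
  zero_mul h := eq_mul
    (by rw [toBCF_zero, zero_mul]; exact (0 : HarmonicFunction μ).hasBoundaryLimit)
  mul_zero h := eq_mul
    (by rw [toBCF_zero, mul_zero]; exact (0 : HarmonicFunction μ).hasBoundaryLimit)
  norm_mul_le := HarmonicFunction.norm_mul_le

noncomputable instance : NormedAlgebra ℂ (HarmonicFunction μ) where
  __ := Algebra.ofModule (R := ℂ) (A := HarmonicFunction μ)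
    (fun c h k => by
      rw [HarmonicFunction.mul_comm, HarmonicFunction.mul_smul, HarmonicFunction.mul_comm])
    (fun c h k => HarmonicFunction.mul_smul c h k)
  norm_smul_le c h := norm_smul_le c h

instance : CompleteSpace (HarmonicFunction μ) :=
  (isClosed_harmonicSubmodule (μ := μ)).completeSpace_coe

noncomputable instance : StarRing (HarmonicFunction μ) where
  star_involutive h := ext' fun g => by simp
  star_mul h k := (HarmonicFunction.star_mul h k).trans (HarmonicFunction.mul_comm _ _)
  star_add h k := ext' fun g => by simp

instance : CStarRing (HarmonicFunction μ) where
  norm_mul_self_le := HarmonicFunction.norm_sq_le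

instance : StarModule ℂ (HarmonicFunction μ) where
  star_smul c h := ext' fun g => by simp

/-- The commutative unital C*-algebra `H_μ(G)`: the supremum norm, complex conjugation, and the
multiplication `h₁ ·_μ h₂ = lim_n Φ_{μⁿ}(h₁ h₂)`. -/
noncomputable instance : CommCStarAlgebra (HarmonicFunction μ) where

variable (μ) in
/-- The Poisson boundary `Π_μ(G)`: the Gelfand spectrum of the commutative unital
C*-algebra `H_μ(G)`, with the weak-* topology. -/
abbrev PoissonBoundary : Type _ := WeakDual.characterSpace ℂ (HarmonicFunction μ)

end Poisson

end TopFurstenberg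

/-! A commutative unital C*-algebra with exactly one character is `ℂ`, so the boundary is trivial
exactly when all harmonic functions are constant (`nonempty_unique_poissonBoundary_iff`). The
theorem thus compares amenability with this Liouville property.

From amenability to Liouville, the measure is a mixture `∑ 2⁻¹⁻ⁱ ν i` of finitely supported
measures. A step of the random walk uses some `ν j` with `j ≥ i` with probability `2⁻ⁱ`, so among `i
* 2 ^ i` steps such a step is missing only with probability at most `e⁻ⁱ`. Until then the walk has
moved by few elements of a finite set carrying `ν 0, …, ν (i - 1)`. If every `ν j` with `j ≥ i` is
almost invariant under all the points reachable in this way from `1, z 0, …, z i`, that step forgets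
the starting point. A harmonic function then has nearly equal values at `1` and at `z k`, `k ≤ i`
(`norm_sub_le_of_steps`). Letting `i → ∞`, with `z` dense, shows that it is constant. Atoms at the
points `z i` give full support, and a countable carrier gives regularity.

The `ν i` must serve all of `RUCB G` at once. Hence almost invariance is required uniformly on the
Lipschitz unit ball of a right-invariant pseudometric, whose multiples approximate every bounded
real right-uniformly continuous function. This ball is compact for pointwise convergence, so
Hahn-Banach separation in `G → ℝ` turns the invariant mean into finitely supported vectors
(`IsAmenable.exists_almost_invariant`).

Conversely, let `m` be an ultrafilter limit of the Cesàro averages of the `μᵏ`. For `f` in `RUCB G`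
the function `x ↦ m (f ∘ λ_x)` is harmonic, hence constant, which says that `m` is invariant
(`isAmenable_of_liouville`). -/

namespace TopFurstenberg

/-! ### Right-invariant pseudometrics for the right uniformity. -/

section Metric

/-- A right-invariant real-valued pseudometric on a group. -/
structure RightInvPseudoMetric (G : Type*) [Group G] where
  /-- The distance function. -/
  d : G → G → ℝ
  self : ∀ x, d x x = 0
  symm : ∀ x y, d x y = d y x
  triangle : ∀ x y z, d x z ≤ d x y + d y z
  nonneg : ∀ x y, 0 ≤ d x y
  mul_right : ∀ x y z, d (x * z) (y * z) = d x y

/-- A right-invariant pseudometric induces the right uniform structure of the group. -/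
def RightInvPseudoMetric.IsCompatible {G : Type*} [Group G] [TopologicalSpace G]
    (ρ : RightInvPseudoMetric G) : Prop :=
  (∀ ε > 0, ∃ U ∈ 𝓝 (1 : G), ∀ x y, x * y⁻¹ ∈ U → ρ.d x y ≤ ε) ∧
    ∀ U ∈ 𝓝 (1 : G), ∃ δ > 0, ∀ x y, ρ.d x y < δ → x * y⁻¹ ∈ U

/-- Metrization of countably generated uniformities, with the distance as a bare function, ready to
be modified into an invariant one. -/
theorem exists_dist_of_countably_generated (X : Type*) [UniformSpace X]
    [IsCountablyGenerated (uniformity X)] :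
    ∃ r : X → X → ℝ, (∀ x, r x x = 0) ∧ (∀ x y, r x y = r y x) ∧
      (∀ x y z, r x z ≤ r x y + r y z) ∧
      ∀ s : Set (X × X), s ∈ uniformity X ↔ ∃ ε > 0, ∀ x y, r x y < ε → (x, y) ∈ s := by
  let := UniformSpace.pseudoMetricSpace X
  refine ⟨dist, dist_self, dist_comm, dist_triangle, fun s => ?_⟩
  rw [Metric.mem_uniformity_dist]

/-- A metrizing distance becomes right-invariant after a supremum over right translates; truncation
at `1` keeps this finite. The uniformity does not change, because `(x z)(y z)⁻¹ = x y⁻¹` makes its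
basic entourages right-invariant. -/
theorem exists_rightInvPseudoMetric (G : Type*) [Group G] [TopologicalSpace G]
    [IsTopologicalGroup G] [FirstCountableTopology G] :
    ∃ ρ : RightInvPseudoMetric G, ρ.IsCompatible := by
  let : UniformSpace G := IsTopologicalGroup.rightUniformSpace G
  have hu : uniformity G = comap (fun p : G × G => p.2 * p.1⁻¹) (𝓝 1) := rfl
  have : IsCountablyGenerated (uniformity G) := by rw [hu]; infer_instance
  obtain ⟨r, r0, rs, rt, ru⟩ := exists_dist_of_countably_generated G
  have rn : ∀ x y, 0 ≤ r x y := fun x y => by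
    have := rt x y x; rw [r0, rs y x] at this; linarith
  have hb : ∀ x y, BddAbove (Set.range fun z => min 1 (r (x * z) (y * z))) := fun x y =>
    ⟨1, by rintro _ ⟨z, rfl⟩; exact min_le_left _ _⟩
  refine ⟨⟨fun x y => ⨆ z, min 1 (r (x * z) (y * z)), fun x => by simp [r0],
    fun x y => by simp only [rs], fun x y z => ?_, fun x y => ?_, fun x y z => ?_⟩, ?_, ?_⟩
  · refine ciSup_le fun w => ?_
    have h1 := le_ciSup (hb x y) w
    have h2 := le_ciSup (hb y z) w
    refine le_trans ?_ (add_le_add h1 h2)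
    have := rt (x * w) (y * w) (z * w)
    have a := rn (x * w) (y * w)
    have b := rn (y * w) (z * w)
    simp only [min_def]
    split_ifs <;> linarith
  · exact Real.iSup_nonneg fun z => le_min zero_le_one (rn _ _)
  · simp only [mul_assoc]
    exact (Equiv.mulLeft z).iSup_congr fun w => rfl
  · intro ε hε
    have h1 : {p : G × G | r p.1 p.2 < ε} ∈ uniformity G := (ru _).2 ⟨ε, hε, fun x y h => h⟩
    rw [hu, mem_comap] at h1
    obtain ⟨U, hU, hUs⟩ := h1
    refine ⟨U, hU, fun x y hxy => ciSup_le fun z => (min_le_right _ _).trans ?_⟩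
    -- The entourages are given by `p.2 * p.1⁻¹`, so the pair occurs in reversed order.
    rw [rs]
    have : (y * z, x * z) ∈ {p : G × G | r p.1 p.2 < ε} := hUs (by simpa [mul_assoc] using hxy)
    exact le_of_lt this
  · intro U hU
    have h1 : (fun p : G × G => p.2 * p.1⁻¹) ⁻¹' U ∈ uniformity G := preimage_mem_comap hU
    obtain ⟨δ, hδ, h⟩ := (ru _).1 h1
    -- Below `1` the truncation is inactive, and the translate by `1` recovers the original
    -- distance.
    refine ⟨min 1 δ, by positivity, fun x y hxy => h y x ?_⟩
    have h2 := (le_ciSup (hb x y) 1).trans_lt hxy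
    rw [mul_one, mul_one, min_lt_iff] at h2
    rw [rs]
    rcases h2 with h2 | h2
    · exact absurd h2 (not_lt.2 (min_le_left _ _))
    · exact h2.trans_le (min_le_right _ _)

end Metric

/-! ### The Lipschitz unit ball: compactness and approximation. -/

section Lipschitz

variable {G : Type*} [Group G]

/-- The set of `1`-Lipschitz functions with values in `[-1, 1]`. -/
def RightInvPseudoMetric.unitLip (ρ : RightInvPseudoMetric G) : Set (G → ℝ) :=
  {h | (∀ x, |h x| ≤ 1) ∧ ∀ x y, |h x - h y| ≤ ρ.d x y}

theorem RightInvPseudoMetric.convex_unitLip (ρ : RightInvPseudoMetric G) :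
    Convex ℝ ρ.unitLip := by
  rintro f ⟨hf, hf'⟩ h ⟨hh, hh'⟩ a b ha hb hab
  have key : ∀ u v r : ℝ, |u| ≤ r → |v| ≤ r → |a * u + b * v| ≤ r := fun u v r hu hv => by
    refine (abs_add_le _ _).trans ?_
    rw [abs_mul, abs_mul, abs_of_nonneg ha, abs_of_nonneg hb]
    calc a * |u| + b * |v| ≤ a * r + b * r := by gcongr
      _ = r := by rw [← add_mul, hab, one_mul]
  refine ⟨fun x => key _ _ _ (hf x) (hh x), fun x y => ?_⟩
  have := key _ _ _ (hf' x y) (hh' x y)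
  simp only [Pi.add_apply, Pi.smul_apply, smul_eq_mul]
  convert this using 2
  ring

/-- For pointwise convergence this is a closed subset of a Tychonoff cube. -/
theorem RightInvPseudoMetric.isCompact_unitLip (ρ : RightInvPseudoMetric G) :
    IsCompact ρ.unitLip := by
  have hc : IsCompact (Set.univ.pi fun _ : G => Set.Icc (-1 : ℝ) 1) :=
    isCompact_univ_pi fun _ => isCompact_Icc
  refine hc.of_isClosed_subset ?_ fun f hf x _ => abs_le.1 (hf.1 x)
  have : ρ.unitLip = (⋂ x, {h : G → ℝ | |h x| ≤ 1}) ∩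
      ⋂ x, ⋂ y, {h : G → ℝ | |h x - h y| ≤ ρ.d x y} := by
    ext h; simp [RightInvPseudoMetric.unitLip]
  rw [this]
  refine (isClosed_iInter fun x => ?_).inter (isClosed_iInter fun x => isClosed_iInter fun y => ?_)
  · exact isClosed_le (by fun_prop) continuous_const
  · exact isClosed_le (by fun_prop) continuous_const

variable [TopologicalSpace G]

/-- Bounded right-uniformly continuous functions are uniform limits of Lipschitz functions. -/
theorem RightInvPseudoMetric.IsCompatible.exists_unitLip_approx {ρ : RightInvPseudoMetric G}
    (hρ : ρ.IsCompatible) {f : G → ℝ} {C : ℝ} (hC : ∀ x, |f x| ≤ C)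
    (hf : ∀ ε : ℝ, 0 < ε → ∃ U ∈ 𝓝 (1 : G), ∀ x y : G, x * y⁻¹ ∈ U → |f x - f y| ≤ ε)
    {δ : ℝ} (hδ : 0 < δ) :
    ∃ M > 0, ∃ h ∈ ρ.unitLip, ∀ x, |f x - M * h x| ≤ δ := by
  obtain ⟨U, hU, hfU⟩ := hf δ hδ
  obtain ⟨r, hr, hrU⟩ := hρ.2 U hU
  have hC0 : 0 ≤ C := (abs_nonneg _).trans (hC 1)
  -- This slope makes the penalty `L * d` at distance `≥ r` exceed the largest possible oscillation
  -- `2 * C`; at distance `< r` the oscillation is at most `δ` anyway.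
  set L := 2 * C / r with hL
  have hL0 : 0 ≤ L := by positivity
  have hlow : ∀ x y, f x - δ ≤ f y + L * ρ.d x y := fun x y => by
    rcases lt_or_ge (ρ.d x y) r with h | h
    · have h1 := abs_le.1 (hfU x y (hrU x y h))
      have h2 := mul_nonneg hL0 (ρ.nonneg x y)
      linarith [h1.2]
    · have h1 : L * r ≤ L * ρ.d x y := by gcongr
      have h2 : L * r = 2 * C := by rw [hL]; field_simp
      have := (abs_le.1 (hC x)).2
      have := (abs_le.1 (hC y)).1
      linarith
  have hb : ∀ x, BddBelow (Set.range fun y => f y + L * ρ.d x y) := fun x =>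
    ⟨f x - δ, by rintro _ ⟨y, rfl⟩; exact hlow x y⟩
  -- Inf-convolution with the distance: `L`-Lipschitz, with `f - δ ≤ h ≤ f`.
  let h : G → ℝ := fun x => ⨅ y, f y + L * ρ.d x y
  have h1 : ∀ x, h x ≤ f x := fun x => by
    refine (ciInf_le (hb x) x).trans ?_
    simp [ρ.self]
  have h2 : ∀ x, f x - δ ≤ h x := fun x => le_ciInf (hlow x)
  have h3 : ∀ x, -C ≤ h x := fun x => le_ciInf fun y => by
    have := (abs_le.1 (hC y)).1
    have := mul_nonneg hL0 (ρ.nonneg x y)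
    linarith
  have h4 : ∀ x y, h x - L * ρ.d x y ≤ h y := fun x y => le_ciInf fun z => by
    have e1 := ciInf_le (hb x) z
    have e2 := mul_le_mul_of_nonneg_left (ρ.triangle x y z) hL0
    change h x ≤ _ at e1
    linarith
  -- One divisor normalizes both the bound `C` and the slope `L`; the `1` keeps it positive when
  -- both vanish.
  have hM : 0 < C + L + 1 := by positivity
  refine ⟨C + L + 1, hM, fun x => h x / (C + L + 1), ⟨fun x => ?_, fun x y => ?_⟩, fun x => ?_⟩
  · rw [abs_div, abs_of_pos hM, div_le_one hM, abs_le]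
    have := (abs_le.1 (hC x)).2
    constructor <;> linarith [h1 x, h3 x]
  · rw [← sub_div, abs_div, abs_of_pos hM, div_le_iff₀ hM, abs_le]
    have e1 := h4 x y
    have e2 := h4 y x
    rw [ρ.symm] at e2
    have e3 := ρ.nonneg x y
    constructor <;> nlinarith
  · rw [mul_div_cancel₀ _ hM.ne', abs_le]
    constructor <;> linarith [h1 x, h2 x]

theorem RightInvPseudoMetric.IsCompatible.isRightUnifCont {ρ : RightInvPseudoMetric G}
    (hρ : ρ.IsCompatible) {h : G → ℝ} (hh : h ∈ ρ.unitLip) :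
    IsRightUnifCont fun x => (h x : ℂ) := fun ε hε => by
  obtain ⟨U, hU, H⟩ := hρ.1 ε hε
  refine ⟨U, hU, fun x y hxy => ?_⟩
  rw [← Complex.ofReal_sub, Complex.norm_real, Real.norm_eq_abs]
  exact (hh.2 x y).trans (H x y hxy)

end Lipschitz

/-! ### Almost invariant finitely supported vectors by Hahn-Banach. -/

section AlmostInvariance

/-- A continuous linear functional on a product of lines is a finite combination of coordinates. -/
theorem exists_eq_sum_of_continuous_pi {X : Type*} [DecidableEq X] (l : (X → ℝ) →L[ℝ] ℝ) :
    ∃ S : Finset X, ∀ F : X → ℝ, l F = ∑ x ∈ S, F x * l (Pi.single x 1) := by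
  have h1 : {F : X → ℝ | |l F| < 1} ∈ 𝓝 (0 : X → ℝ) := by
    have : Continuous fun F : X → ℝ => |l F| := by fun_prop
    exact this.continuousAt.preimage_mem_nhds (Iio_mem_nhds (by simp))
  rw [nhds_pi, Filter.mem_pi] at h1
  obtain ⟨I, hI, t, ht, hs⟩ := h1
  -- The box leaves coordinates outside `I` free, so it contains every multiple of such an `F`; a
  -- nonzero `l F` could be rescaled to `1`.
  have h0 : ∀ F : X → ℝ, (∀ x ∈ I, F x = 0) → l F = 0 := fun F hF => by
    by_contra hne
    have h2 : (l F)⁻¹ • F ∈ I.pi t := fun x hx => by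
      simp only [Pi.smul_apply, hF x hx, smul_zero]
      exact mem_of_mem_nhds (ht x)
    have h3 := hs h2
    rw [Set.mem_ofPred_eq, map_smul, smul_eq_mul, inv_mul_cancel₀ hne] at h3
    norm_num at h3
  refine ⟨hI.toFinset, fun F => ?_⟩
  have h2 := h0 (F - ∑ x ∈ hI.toFinset, F x • Pi.single x (1 : ℝ)) fun y hy => by
    simp [Finset.sum_apply, Pi.single_apply, hy]
  rw [map_sub, map_sum, sub_eq_zero] at h2
  simpa using h2

variable {G : Type*} [Group G] [TopologicalSpace G] [IsTopologicalGroup G]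

/-- A function in the Lipschitz unit ball as an element of `RUCB G`. -/
noncomputable def RightInvPseudoMetric.IsCompatible.toRUCB {ρ : RightInvPseudoMetric G}
    (hρ : ρ.IsCompatible) (h : ρ.unitLip) : RUCB G :=
  ⟨BoundedContinuousFunction.ofNormedAddCommGroup (fun x => ((h : G → ℝ) x : ℂ))
    (let := borel G; (hρ.isRightUnifCont h.2).continuous) 1 fun x => by
      rw [Complex.norm_real]; exact h.2.1 x, hρ.isRightUnifCont h.2⟩

theorem RightInvPseudoMetric.IsCompatible.toRUCB_apply {ρ : RightInvPseudoMetric G}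
    (hρ : ρ.IsCompatible) (h : ρ.unitLip) (x : G) :
    (hρ.toRUCB h : G →ᵇ ℂ) x = ((h : G → ℝ) x : ℂ) := rfl

/-- In an amenable group, a sum of coboundaries is not bounded below by a positive constant. -/
theorem IsAmenable.exists_sum_coboundary_lt (hG : IsAmenable G) {ι : Type*} [Fintype ι]
    {ρ : RightInvPseudoMetric G} (hρ : ρ.IsCompatible) (g : ι → G) (F : ι → G → ℝ)
    (hF : ∀ i, F i ∈ ρ.unitLip) {ε : ℝ} (hε : 0 < ε) :
    ∃ x, ∑ i, (F i (g i * x) - F i x) < ε := by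
  obtain ⟨m, ⟨hpos, hone⟩, hinv⟩ := hG
  by_contra! hcon
  let f : ι → RUCB G := fun i => hρ.toRUCB ⟨F i, hF i⟩
  -- By `hcon` this function is nonnegative, whereas an invariant state gives it the value `-ε`.
  have h1 := hpos (∑ i, (leftTranslate (g i) (f i) - f i) - (ε : ℂ) • 1) fun x => by
    have e : ((∑ i, (leftTranslate (g i) (f i) - f i) - (ε : ℂ) • 1 : RUCB G) : G →ᵇ ℂ) x
        = ((∑ i, (F i (g i * x) - F i x) - ε : ℝ) : ℂ) := by
      simp [f, hρ.toRUCB_apply]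
    rw [e]
    exact_mod_cast sub_nonneg.2 (hcon x)
  rw [map_sub, map_sum, map_smul, hone] at h1
  simp only [map_sub, hinv, sub_self, Finset.sum_const_zero, zero_sub, smul_eq_mul, mul_one] at h1
  rw [← Complex.ofReal_neg] at h1
  have := Complex.zero_le_real.1 h1
  linarith

open Classical in
/-- An amenable group carries finitely supported probability vectors which are almost invariant,
uniformly on the Lipschitz unit ball. -/
theorem IsAmenable.exists_almost_invariant (hG : IsAmenable G) {ρ : RightInvPseudoMetric G}
    (hρ : ρ.IsCompatible) (K : Finset G) {ε : ℝ} (hε : 0 < ε) :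
    ∃ (S : Finset G) (a : G → ℝ), (∀ x, 0 ≤ a x) ∧ ∑ x ∈ S, a x = 1 ∧
      ∀ h ∈ ρ.unitLip, ∀ g ∈ K, |∑ x ∈ S, h (g * x) * a x - ∑ x ∈ S, h x * a x| ≤ ε := by
  let T : (K → G → ℝ) →ₗ[ℝ] (G → ℝ) :=
    { toFun := fun F x => ∑ g : K, (F g (g * x) - F g x)
      map_add' := fun F F' => by
        ext x
        simp only [Pi.add_apply, ← Finset.sum_add_distrib]
        exact Finset.sum_congr rfl fun _ _ => by ring
      map_smul' := fun c F => by
        ext x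
        simp only [Pi.smul_apply, smul_eq_mul, Finset.mul_sum, RingHom.id_apply]
        exact Finset.sum_congr rfl fun _ _ => by ring }
  have hT : Continuous T := by
    change Continuous fun (F : K → G → ℝ) x => ∑ g : K, (F g (g * x) - F g x)
    fun_prop
  let X : Set (K → G → ℝ) := Set.univ.pi fun _ => ρ.unitLip
  have h0 : (0 : G → ℝ) ∈ ρ.unitLip := ⟨fun x => by simp, fun x y => by simpa using ρ.nonneg x y⟩
  have hXc : Convex ℝ (T '' X) := (convex_pi fun _ _ => ρ.convex_unitLip).linear_image T
  have hXk : IsCompact (T '' X) := (isCompact_univ_pi fun _ => ρ.isCompact_unitLip).image hT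
  let t : Set (G → ℝ) := {F | ∀ x, ε ≤ F x}
  have htc : Convex ℝ t := by
    intro f hf h hh a b ha hb hab x
    simp only [Pi.add_apply, Pi.smul_apply, smul_eq_mul]
    calc ε = a * ε + b * ε := by rw [← add_mul, hab, one_mul]
      _ ≤ _ := by gcongr; exacts [hf x, hh x]
  have htk : IsClosed t := by
    rw [show t = ⋂ x, {F : G → ℝ | ε ≤ F x} by ext; simp [t]]
    exact isClosed_iInter fun x => isClosed_le continuous_const (by fun_prop)
  have hdisj : Disjoint (T '' X) t := by
    rw [Set.disjoint_left]
    rintro _ ⟨F, hF, rfl⟩ hFt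
    obtain ⟨x, hx⟩ := hG.exists_sum_coboundary_lt hρ (fun g : K => (g : G)) F
      (fun g => hF g trivial) hε
    exact absurd (hFt x) (not_le.2 hx)
  -- Separation takes place in the product topology, so that `l` is a finite combination of point
  -- evaluations and not merely a mean.
  obtain ⟨l, u, v, hu, huv, hv⟩ := geometric_hahn_banach_compact_closed hXc hXk htc htk hdisj
  have hu0 : 0 < u := by
    have := hu (T 0) ⟨0, fun _ _ => h0, rfl⟩
    simpa using this
  let e : G → ℝ := fun _ => ε
  have he : v < l e := hv e fun x => le_rfl
  have hlpos : ∀ p : G → ℝ, (∀ x, 0 ≤ p x) → 0 ≤ l p := fun p hp => by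
    by_contra! hneg
    -- Adding nonnegative functions does not leave `t`; this multiple of `p` is chosen so that `l`
    -- vanishes, contradicting `0 < u < v`.
    have h1 := hv (e + (l e / -l p) • p) fun x => by
      have : 0 ≤ l e / -l p := div_nonneg (by linarith) (by linarith)
      have := mul_nonneg this (hp x)
      simpa [e] using this
    rw [map_add, map_smul, smul_eq_mul, div_neg, neg_mul, div_mul_cancel₀ _ hneg.ne] at h1
    linarith
  obtain ⟨S, hS⟩ := exists_eq_sum_of_continuous_pi l
  set w := l 1 with hw
  have hew : l e = ε * w := by
    rw [show e = ε • (1 : G → ℝ) by ext; simp [e], map_smul, smul_eq_mul]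
  have hw0 : 0 < w := by
    have : 0 < ε * w := by linarith
    exact pos_of_mul_pos_right this hε.le
  have hsum : ∀ h : G → ℝ, ∑ x ∈ S, h x * (l (Pi.single x 1) / w) = l h / w := fun h => by
    rw [hS h, Finset.sum_div]
    exact Finset.sum_congr rfl fun x _ => by ring
  refine ⟨S, fun x => l (Pi.single x 1) / w, fun x => div_nonneg (hlpos _ fun y => ?_) hw0.le,
    ?_, ?_⟩
  · rw [Pi.single_apply]; split_ifs <;> norm_num
  · have := hsum 1
    simpa [← hw, hw0.ne'] using this
  · have key : ∀ h ∈ ρ.unitLip, ∀ g ∈ K, l (fun x => h (g * x)) - l h ≤ ε * w := by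
      intro h hh g hg
      -- A family supported at one `g` isolates a single coboundary, where `l < u < v < l e = ε *
      -- w`.
      have h1 := hu (T (Pi.single ⟨g, hg⟩ h)) ⟨_, fun k _ => by
        by_cases hk : k = ⟨g, hg⟩
        · subst hk; simpa using hh
        · simpa [Pi.single_apply, hk] using h0, rfl⟩
      have h2 : T (Pi.single ⟨g, hg⟩ h) = (fun x => h (g * x)) - h := by
        ext x
        change ∑ k : K, ((Pi.single (⟨g, hg⟩ : K) h : K → G → ℝ) k (k * x)
          - (Pi.single (⟨g, hg⟩ : K) h : K → G → ℝ) k x) = _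
        rw [Finset.sum_eq_single ⟨g, hg⟩]
        · simp
        · intro k _ hk
          simp [hk]
        · simp
      rw [h2, map_sub] at h1
      linarith
    intro h hh g hg
    rw [hsum fun x => h (g * x), hsum, ← sub_div, abs_div, abs_of_pos hw0, div_le_iff₀ hw0, abs_le]
    have k1 := key h hh g hg
    have k2 := key (-h) ⟨fun x => by simpa using hh.1 x, fun x y => by
      rw [Pi.neg_apply, Pi.neg_apply, ← abs_neg]
      simpa [sub_eq_add_neg, add_comm] using hh.2 x y⟩ g hg
    rw [show (fun x => (-h) (g * x)) = -fun x => h (g * x) from rfl, map_neg, map_neg] at k2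
    constructor <;> linarith

end AlmostInvariance

/-! ### From vectors to probability measures with a prescribed atom. -/

section AlmostInvariantMeasure

variable {G : Type*} [Group G] [TopologicalSpace G] [IsTopologicalGroup G]
  [MeasurableSpace G] [MeasurableSingletonClass G]

/-- The finitely supported measures of `IsAmenable.exists_almost_invariant`, with a prescribed
atom. -/
theorem IsAmenable.exists_almost_invariant_measure (hG : IsAmenable G)
    {ρ : RightInvPseudoMetric G} (hρ : ρ.IsCompatible) (K : Finset G) {ε : ℝ} (hε : 0 < ε)
    (z : G) :
    ∃ (ν : Measure G) (S : Finset G), IsProbabilityMeasure ν ∧ (∀ᵐ x ∂ν, x ∈ S) ∧ ν {z} ≠ 0 ∧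
      ∀ h ∈ ρ.unitLip, ∀ g ∈ K, |∫ x, h (g * x) ∂ν - ∫ x, h x ∂ν| ≤ ε := by
  classical
  obtain ⟨S, a, ha, hsum, hinv⟩ := hG.exists_almost_invariant hρ K (half_pos hε)
  let ν₀ : Measure G := ∑ x ∈ S, ENNReal.ofReal (a x) • Measure.dirac x
  have hI₀ : ∀ h : G → ℝ, Integrable h ν₀ := fun h =>
    integrable_finsetSum_measure.2 fun x _ =>
      (integrable_dirac (by simp)).smul_measure ENNReal.ofReal_ne_top
  have hi₀ : ∀ h : G → ℝ, ∫ x, h x ∂ν₀ = ∑ x ∈ S, h x * a x := fun h => by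
    rw [integral_finsetSum_measure fun x _ =>
      (integrable_dirac (by simp)).smul_measure ENNReal.ofReal_ne_top]
    refine Finset.sum_congr rfl fun x _ => ?_
    rw [integral_smul_measure, integral_dirac, ENNReal.toReal_ofReal (ha x), smul_eq_mul, mul_comm]
  have huniv : ν₀ Set.univ = 1 := by
    simp only [ν₀, Measure.finsetSum_apply, Measure.smul_apply, measure_univ, smul_eq_mul, mul_one]
    rw [← ENNReal.ofReal_sum_of_nonneg fun x _ => ha x, hsum, ENNReal.ofReal_one]
  -- An atom of mass `θ` contributes at most `2 * θ ≤ ε / 2`, since `|h| ≤ 1`; the other `ε / 2`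
  -- comes from the almost invariant vector.
  set θ : ℝ := min 1 (ε / 4) with hθ
  have hθ0 : 0 < θ := by positivity
  have hθ1 : θ ≤ 1 := min_le_left _ _
  have hθ2 : θ ≤ ε / 4 := min_le_right _ _
  refine ⟨ENNReal.ofReal (1 - θ) • ν₀ + ENNReal.ofReal θ • Measure.dirac z, insert z S,
    ⟨?_⟩, ?_, ?_, ?_⟩
  · rw [Measure.add_apply, Measure.smul_apply, Measure.smul_apply, huniv, measure_univ,
      smul_eq_mul, smul_eq_mul, mul_one, mul_one,
      ← ENNReal.ofReal_add (by linarith) hθ0.le, sub_add_cancel, ENNReal.ofReal_one]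
  · rw [ae_iff]
    have h1 : ∀ x ∈ insert z S, Measure.dirac x {y | y ∉ insert z S} = 0 := fun x hx => by
      rw [Measure.dirac_apply, Set.indicator_of_notMem (not_not.2 hx)]
    rw [Measure.add_apply, Measure.smul_apply, Measure.smul_apply, h1 z (by simp),
      Measure.finsetSum_apply, Finset.sum_eq_zero fun x hx => ?_]
    · simp
    · rw [Measure.smul_apply, h1 x (by simp [hx]), smul_zero]
  · rw [Measure.add_apply, Measure.smul_apply (ENNReal.ofReal θ)]
    simp [hθ0]
  · intro h hh g hg
    have hi : ∀ k : G → ℝ, ∫ x, k x ∂(ENNReal.ofReal (1 - θ) • ν₀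
        + ENNReal.ofReal θ • Measure.dirac z) = (1 - θ) * (∑ x ∈ S, k x * a x) + θ * k z := by
      intro k
      rw [integral_add_measure ((hI₀ k).smul_measure ENNReal.ofReal_ne_top)
        ((integrable_dirac (by simp)).smul_measure ENNReal.ofReal_ne_top),
        integral_smul_measure, integral_smul_measure, hi₀, integral_dirac,
        ENNReal.toReal_ofReal (by linarith), ENNReal.toReal_ofReal hθ0.le, smul_eq_mul, smul_eq_mul]
    rw [hi fun x => h (g * x), hi h]
    have h1 := abs_le.1 (hinv h hh g hg)
    have h2 := abs_le.1 (hh.1 (g * z))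
    have h3 := abs_le.1 (hh.1 z)
    rw [abs_le]
    constructor <;> nlinarith

end AlmostInvariantMeasure

/-! ### Recursive choice of the measures. -/

section Sequence

open scoped Pointwise

variable {G : Type*} [Group G]

open Classical in
/-- The finite set of group elements under which the `i`-th measure of the construction is required
to be almost invariant: it grows with the supports `T` of the earlier measures. -/
noncomputable def testSet (z : ℕ → G) (T : ℕ → Finset G) (i : ℕ) : Finset G :=
  insert 1 ((Finset.range (i + 1)).image z) * (insert 1 (T i)) ^ (i * 2 ^ i)

/-- Monotonicity makes every later measure almost invariant under the earlier test sets as well.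
Inserting `1` is what lets the powers grow with the exponent. -/
theorem testSet_mono (z : ℕ → G) {T : ℕ → Finset G} (hT : Monotone T) :
    Monotone (testSet z T) := by
  classical
  intro i j hij
  have h1 : i * 2 ^ i ≤ j * 2 ^ j :=
    Nat.mul_le_mul hij (Nat.pow_le_pow_right (by norm_num) hij)
  unfold testSet
  refine Finset.mul_subset_mul ?_ ?_
  · gcongr
  · refine (Finset.pow_subset_pow_left (Finset.insert_subset_insert _ (hT hij))).trans
      (Finset.pow_subset_pow_right (by simp) h1)

variable [TopologicalSpace G] [IsTopologicalGroup G]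
  [MeasurableSpace G] [MeasurableSingletonClass G]

/-- A sequence of finitely supported probability measures, each almost invariant under the
test set given by the supports of its predecessors. -/
theorem IsAmenable.exists_measure_seq (hG : IsAmenable G)
    {ρ : RightInvPseudoMetric G} (hρ : ρ.IsCompatible) (z : ℕ → G) :
    ∃ (ν : ℕ → Measure G) (T : ℕ → Finset G), Monotone T ∧ (∀ i, IsProbabilityMeasure (ν i)) ∧
      (∀ j i, j < i → ∀ᵐ x ∂ν j, x ∈ T i) ∧ (∀ i, ν i {z i} ≠ 0) ∧
      ∀ i, ∀ h ∈ ρ.unitLip, ∀ g ∈ testSet z T i,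
        |∫ x, h (g * x) ∂ν i - ∫ x, h x ∂ν i| ≤ 1 / (i + 1) := by
  classical
  choose N S hN hS hz hinv using fun (i : ℕ) (T : Finset G) =>
    hG.exists_almost_invariant_measure hρ (testSet z (fun _ => T) i)
      (ε := 1 / (i + 1)) (by positivity) (z i)
  -- `T i` collects the supports of the measures of index `< i` only, so the choice of the `i`-th
  -- measure is not circular.
  let T : ℕ → Finset G := fun n => Nat.rec ∅ (fun i T => T ∪ S i T) n
  have hT : Monotone T := monotone_nat_of_le_succ fun n => Finset.subset_union_left
  refine ⟨fun i => N i (T i), T, hT, fun i => hN _ _, fun j i hij => ?_, fun i => hz _ _,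
    fun i => hinv i (T i)⟩
  filter_upwards [hS j (T j)] with x hx
  exact hT (Nat.succ_le_of_lt hij) (Finset.mem_union_right (T j) hx)

end Sequence

/-! ### Almost invariance on all of `RUCB G`. -/

section Oscillation

variable {G : Type*} [Group G] [TopologicalSpace G] [IsTopologicalGroup G]
  [MeasurableSpace G] [BorelSpace G]

theorem integrable_translate {ν : Measure G} [IsProbabilityMeasure ν] {f : G → ℝ}
    (hc : Continuous f) {C : ℝ} (hC : ∀ x, |f x| ≤ C) (g : G) :
    Integrable (fun x => f (g * x)) ν :=
  Integrable.of_bound (hc.comp (continuous_const_mul g)).aestronglyMeasurable C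
    (Eventually.of_forall fun _ => hC _)

/-- Almost invariance on the Lipschitz unit ball passes to all right-uniformly continuous
bounded functions. -/
theorem eventually_almost_invariant_real [SecondCountableTopology G]
    {ρ : RightInvPseudoMetric G} (hρ : ρ.IsCompatible)
    {ν : ℕ → Measure G} [∀ i, IsProbabilityMeasure (ν i)] {K : ℕ → Finset G}
    (hν : ∀ i, ∀ h ∈ ρ.unitLip, ∀ g ∈ K i,
      |∫ x, h (g * x) ∂ν i - ∫ x, h x ∂ν i| ≤ 1 / (i + 1))
    {f : G → ℝ} {C : ℝ} (hC : ∀ x, |f x| ≤ C)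
    (hf : IsRightUnifCont fun x => (f x : ℂ)) {ε : ℝ} (hε : 0 < ε) :
    ∀ᶠ i in atTop, ∀ g ∈ K i, |∫ x, f (g * x) ∂ν i - ∫ x, f x ∂ν i| ≤ ε := by
  obtain ⟨M, hM, h, hh, hfh⟩ := hρ.exists_unitLip_approx hC (fun δ hδ => by
    obtain ⟨U, hU, H⟩ := hf δ hδ
    refine ⟨U, hU, fun x y hxy => ?_⟩
    have := H x y hxy
    rwa [← Complex.ofReal_sub, Complex.norm_real, Real.norm_eq_abs] at this)
    (δ := ε / 4) (by positivity)
  have hfc : Continuous f := by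
    have := Complex.continuous_re.comp hf.continuous
    exact this
  have hhc : Continuous h := by
    have := Complex.continuous_re.comp (hρ.isRightUnifCont hh).continuous
    exact this
  have hlim : Tendsto (fun i : ℕ => M * (1 / ((i : ℝ) + 1))) atTop (𝓝 0) := by
    simpa using tendsto_one_div_add_atTop_nhds_zero_nat.const_mul M
  -- Two approximation errors `ε / 4` and the scaled invariance error `M / (i + 1) ≤ ε / 2` add up
  -- to `ε`.
  filter_upwards [hlim.eventually_le_const (half_pos hε)] with i hi g hg
  have key : ∀ g : G, |∫ x, f (g * x) ∂ν i - M * ∫ x, h (g * x) ∂ν i| ≤ ε / 4 := fun g => by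
    rw [← integral_const_mul, ← integral_sub (integrable_translate hfc hC g)
      ((integrable_translate hhc hh.1 g).const_mul M)]
    have := norm_integral_le_of_norm_le_const (μ := ν i) (C := ε / 4)
      (f := fun x => f (g * x) - M * h (g * x)) (Eventually.of_forall fun x => hfh _)
    simpa using this
  have h1 := abs_le.1 (key g)
  have h2 := abs_le.1 (key 1)
  have h3 := abs_le.1 (hν i h hh g hg)
  simp only [one_mul] at h2
  have h4 := mul_le_mul_of_nonneg_left h3.1 hM.le
  have h5 := mul_le_mul_of_nonneg_left h3.2 hM.le
  rw [abs_le]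
  constructor <;> linarith

theorem eventually_almost_invariant [SecondCountableTopology G]
    {ρ : RightInvPseudoMetric G} (hρ : ρ.IsCompatible)
    {ν : ℕ → Measure G} [∀ i, IsProbabilityMeasure (ν i)] {K : ℕ → Finset G}
    (hν : ∀ i, ∀ h ∈ ρ.unitLip, ∀ g ∈ K i,
      |∫ x, h (g * x) ∂ν i - ∫ x, h x ∂ν i| ≤ 1 / (i + 1))
    {f : G →ᵇ ℂ} (hf : f ∈ RUCB G) {ε : ℝ} (hε : 0 < ε) :
    ∀ᶠ i in atTop, ∀ g ∈ K i, ‖Phi (ν i) f g - Phi (ν i) f 1‖ ≤ ε := by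
  have hre := eventually_almost_invariant_real hρ hν (f := fun x => (f x).re) (C := ‖f‖)
    (fun x => (Complex.abs_re_le_norm _).trans (f.norm_coe_le_norm x)) (fun δ hδ => by
      obtain ⟨U, hU, H⟩ := hf δ hδ
      refine ⟨U, hU, fun x y hxy => ?_⟩
      rw [← Complex.ofReal_sub, Complex.norm_real, ← Complex.sub_re]
      exact (Complex.abs_re_le_norm _).trans (H x y hxy)) (half_pos hε)
  have him := eventually_almost_invariant_real hρ hν (f := fun x => (f x).im) (C := ‖f‖)
    (fun x => (Complex.abs_im_le_norm _).trans (f.norm_coe_le_norm x)) (fun δ hδ => by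
      obtain ⟨U, hU, H⟩ := hf δ hδ
      refine ⟨U, hU, fun x y hxy => ?_⟩
      rw [← Complex.ofReal_sub, Complex.norm_real, ← Complex.sub_im]
      exact (Complex.abs_im_le_norm _).trans (H x y hxy)) (half_pos hε)
  filter_upwards [hre, him] with i h1 h2 g hg
  have e1 : ∀ g, (Phi (ν i) f g).re = ∫ x, (f (g * x)).re ∂ν i := fun g =>
    (integral_re (Phi_mul_integrable (ν i) f g)).symm
  have e2 : ∀ g, (Phi (ν i) f g).im = ∫ x, (f (g * x)).im ∂ν i := fun g =>
    (integral_im (Phi_mul_integrable (ν i) f g)).symm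
  refine (Complex.norm_le_abs_re_add_abs_im _).trans ?_
  rw [Complex.sub_re, Complex.sub_im, e1, e1, e2, e2]
  simp only [one_mul]
  linarith [h1 g hg, h2 g hg]

end Oscillation

/-! ### Geometric mixtures of measures. -/

section Mixture

variable {G : Type*} [MeasurableSpace G]

/-- The mixture `∑ i, 2⁻¹⁻ⁱ ν i` of a sequence of measures. -/
noncomputable def mixture (ν : ℕ → Measure G) : Measure G :=
  Measure.sum fun i => ENNReal.ofReal ((1 / 2) ^ (i + 1)) • ν i

theorem hasSum_mixture_weights : HasSum (fun i : ℕ => (1 / 2 : ℝ) ^ (i + 1)) 1 := by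
  have := hasSum_geometric_two.mul_left (1 / 2 : ℝ)
  simpa [pow_succ'] using this

theorem sum_mixture_weights (i : ℕ) :
    ∑ j ∈ Finset.range i, (1 / 2 : ℝ) ^ (j + 1) = 1 - (1 / 2) ^ i := by
  induction i with
  | zero => simp
  | succ n ih => rw [Finset.sum_range_succ, ih]; ring

instance (ν : ℕ → Measure G) [∀ i, IsProbabilityMeasure (ν i)] :
    IsProbabilityMeasure (mixture ν) := by
  refine ⟨?_⟩
  rw [mixture, Measure.sum_apply _ MeasurableSet.univ]
  simp only [Measure.smul_apply, measure_univ, smul_eq_mul, mul_one]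
  rw [← ENNReal.ofReal_tsum_of_nonneg (fun i => by positivity) hasSum_mixture_weights.summable,
    hasSum_mixture_weights.tsum_eq, ENNReal.ofReal_one]

theorem hasSum_integral_mixture {ν : ℕ → Measure G} {f : G → ℂ}
    (hf : Integrable f (mixture ν)) :
    HasSum (fun i => ((1 / 2 : ℝ) ^ (i + 1) : ℝ) • ∫ x, f x ∂ν i) (∫ x, f x ∂mixture ν) := by
  have := hasSum_integral_measure hf
  have e : (fun i => ∫ x, f x ∂(ENNReal.ofReal ((1 / 2) ^ (i + 1)) • ν i))
      = fun i => ((1 / 2 : ℝ) ^ (i + 1) : ℝ) • ∫ x, f x ∂ν i := funext fun i => by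
    rw [integral_smul_measure, ENNReal.toReal_ofReal (by positivity)]
  rwa [e] at this

theorem ae_mixture_iff {ν : ℕ → Measure G} {p : G → Prop} :
    (∀ᵐ x ∂mixture ν, p x) ↔ ∀ i, ∀ᵐ x ∂ν i, p x := by
  rw [mixture, Measure.ae_sum_iff]
  refine forall_congr' fun i => ?_
  rw [Measure.ae_ennreal_smul_measure_iff]
  simp

theorem mixture_ne_zero {ν : ℕ → Measure G} {s : Set G} (i : ℕ) (h : ν i s ≠ 0) :
    mixture ν s ≠ 0 := fun h0 => by
  have h1 := Measure.le_sum (fun i => ENNReal.ofReal ((1 / 2) ^ (i + 1)) • ν i) i s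
  change _ ≤ mixture ν s at h1
  rw [h0, nonpos_iff_eq_zero, Measure.smul_apply, smul_eq_mul, mul_eq_zero] at h1
  rcases h1 with h1 | h1
  · rw [ENNReal.ofReal_eq_zero] at h1
    have : (0 : ℝ) < (1 / 2) ^ (i + 1) := by positivity
    linarith
  · exact h h1

end Mixture

/-! ### Regularity of measures carried by a countable set. -/

section Regular

variable {G : Type*} [TopologicalSpace G] [MeasurableSpace G]

/-- A measure concentrated on a countable set is inner regular for compact sets. -/
theorem innerRegular_of_countable (μ : Measure G) {S : Set G} (hS : S.Countable)
    (hμ : ∀ᵐ x ∂μ, x ∈ S) : μ.InnerRegular := by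
  refine ⟨fun B _ r hr => ?_⟩
  have h1 : μ B = μ (B ∩ S) := measure_congr (by
    filter_upwards [hμ] with x hx
    exact propext ⟨fun h => ⟨h, hx⟩, fun h => h.1⟩)
  rw [h1] at hr
  rcases (B ∩ S).eq_empty_or_nonempty with h0 | hne
  · rw [h0, measure_empty] at hr
    exact absurd hr not_lt_zero
  obtain ⟨e, he⟩ := (hS.mono (Set.inter_subset_right (s := B))).exists_eq_range hne
  -- Finite, hence compact, initial segments of an enumeration exhaust `B ∩ S`.
  have hU : B ∩ S = ⋃ n, e '' Set.Iic n := by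
    rw [← Set.image_iUnion, Set.iUnion_Iic, Set.image_univ, he]
  have hm : Monotone fun n => e '' Set.Iic n := fun a b hab =>
    Set.image_mono (Set.Iic_subset_Iic.2 hab)
  rw [hU, hm.measure_iUnion] at hr
  obtain ⟨n, hn⟩ := lt_iSup_iff.1 hr
  refine ⟨e '' Set.Iic n, fun x hx => ?_, ((Set.finite_Iic n).image e).isCompact, hn⟩
  have : x ∈ B ∩ S := by rw [hU]; exact Set.mem_iUnion.2 ⟨n, hx⟩
  exact this.1

end Regular

/-! ### The Liouville property of the mixture. -/

section Liouville

open scoped Pointwise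

/-- The weights of index `≥ i` have total mass `(1 / 2) ^ i`. -/
theorem norm_tsum_tail_sub_le {u v : ℕ → ℂ} {C ε : ℝ} (hu : ∀ j, ‖u j‖ ≤ C) (hv : ∀ j, ‖v j‖ ≤ C)
    {i : ℕ} (h : ∀ j, i ≤ j → ‖u j - v j‖ ≤ ε) :
    ‖(∑' j, ((1 / 2 : ℝ) ^ (j + i + 1) : ℝ) • u (j + i)) -
      ∑' j, ((1 / 2 : ℝ) ^ (j + i + 1) : ℝ) • v (j + i)‖ ≤ (1 / 2) ^ i * ε := by
  have hw : HasSum (fun j : ℕ => (1 / 2 : ℝ) ^ (j + i + 1)) ((1 / 2) ^ i) := by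
    have := hasSum_mixture_weights.mul_left ((1 / 2 : ℝ) ^ i)
    rw [mul_one] at this
    refine this.congr_fun ?_
    intro j; ring
  have hs : ∀ w : ℕ → ℂ, (∀ j, ‖w j‖ ≤ C) →
      Summable fun j => ((1 / 2 : ℝ) ^ (j + i + 1) : ℝ) • w (j + i) := fun w hwC =>
    Summable.of_norm_bounded (hw.summable.mul_right C) fun j => by
      rw [norm_smul, Real.norm_of_nonneg (by positivity)]
      gcongr
      exact hwC _
  rw [← (hs u hu).tsum_sub (hs v hv)]
  refine tsum_of_norm_bounded (hw.mul_right ε) fun j => ?_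
  rw [← smul_sub, norm_smul, Real.norm_of_nonneg (by positivity)]
  gcongr
  exact h _ (Nat.le_add_left _ _)

variable {G : Type*} [Group G] [TopologicalSpace G] [IsTopologicalGroup G]
  [MeasurableSpace G] [BorelSpace G]

/-- The approximate Liouville property: a fixed function of a mixture is nearly constant on points
from which the first `i` measures need many steps to leave a set on which the remaining measures
are almost invariant. -/
theorem norm_sub_le_of_steps {ν : ℕ → Measure G} [∀ i, IsProbabilityMeasure (ν i)]
    {f : G →ᵇ ℂ} (hf : Phi (mixture ν) f = f) {i : ℕ} {T K : Set G} {ε : ℝ}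
    (hT : ∀ j < i, ∀ᵐ x ∂ν j, x ∈ T)
    (hK : ∀ j, i ≤ j → ∀ g ∈ K, ‖Phi (ν j) f g - Phi (ν j) f 1‖ ≤ ε) :
    ∃ c : ℂ, ∀ n : ℕ, ∀ x : G, (∀ y ∈ (insert 1 T) ^ n, x * y ∈ K) →
      ‖f x - c‖ ≤ (1 - (1 / 2) ^ i) ^ n * (2 * ‖f‖) + ε := by
  set s : ℝ := 1 - (1 / 2) ^ i with hs
  have hs0 : 0 ≤ s := by
    have : (1 / 2 : ℝ) ^ i ≤ 1 := pow_le_one₀ (by norm_num) (by norm_num)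
    linarith
  have hq0 : (0 : ℝ) < (1 / 2) ^ i := by positivity
  have hPb : ∀ j g, ‖Phi (ν j) f g‖ ≤ ‖f‖ := fun j g => Phi_norm_le (ν j) f.norm_coe_le_norm g
  let B : G → ℂ := fun x => ∑' j, ((1 / 2 : ℝ) ^ (j + i + 1) : ℝ) • Phi (ν (j + i)) f x
  have hsplit : ∀ x, f x = ∑ j ∈ Finset.range i, ((1 / 2 : ℝ) ^ (j + 1) : ℝ) • Phi (ν j) f x
      + B x := fun x => by
    have h1 := hasSum_integral_mixture (Phi_mul_integrable (mixture ν) f x)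
    conv_lhs => rw [← hf]
    exact h1.tsum_eq.symm.trans (h1.summable.sum_add_tsum_nat_add i).symm
  have hB : ∀ x ∈ K, ‖B x - B 1‖ ≤ (1 / 2) ^ i * ε := fun x hx =>
    norm_tsum_tail_sub_le (fun j => hPb j x) (fun j => hPb j 1) fun j hj => hK j hj x hx
  have hB1 : ‖B 1‖ ≤ (1 / 2) ^ i * ‖f‖ := by
    have := norm_tsum_tail_sub_le (u := fun j => Phi (ν j) f 1) (v := 0) (C := ‖f‖) (ε := ‖f‖)
      (i := i) (fun j => hPb j 1) (fun j => by simp) (fun j _ => by simpa using hPb j 1)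
    simpa [B] using this
  -- The tail at `1`, normalized by its mass: the value seen after a step of index `≥ i`, nearly
  -- independent of the position in `K`.
  let c : ℂ := ((1 / 2 : ℝ) ^ i)⁻¹ • B 1
  have hc : B 1 = ((1 / 2 : ℝ) ^ i) • c := by
    rw [smul_smul, mul_inv_cancel₀ hq0.ne', one_smul]
  have hcf : ‖c‖ ≤ ‖f‖ := by
    rw [hc, norm_smul, Real.norm_of_nonneg hq0.le] at hB1
    exact le_of_mul_le_mul_left hB1 hq0
  refine ⟨c, fun n => ?_⟩
  induction n with
  | zero =>
    intro x hx
    have hε : 0 ≤ ε := (norm_nonneg _).trans (hK i le_rfl x (by simpa using hx))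
    have := norm_sub_le (f x) c
    have := f.norm_coe_le_norm x
    rw [pow_zero, one_mul]
    linarith
  | succ n ih =>
    intro x hx
    have hxK : x ∈ K := by
      have : (1 : G) ∈ (insert 1 T) ^ (n + 1) :=
        Set.one_mem_pow (Set.mem_insert 1 T)
      simpa using hx 1 this
    set r := s ^ n * (2 * ‖f‖) + ε with hr
    have hP : ∀ j < i, ‖Phi (ν j) f x - c‖ ≤ r := fun j hj => by
      have e : Phi (ν j) f x - c = ∫ y, (f (x * y) - c) ∂ν j := by
        rw [integral_sub (Phi_mul_integrable (ν j) f x) (integrable_const _)]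
        simp [Phi]
      rw [e]
      refine (norm_integral_le_of_norm_le_const (C := r) ?_).trans (by simp)
      filter_upwards [hT j hj] with y hy
      refine ih (x * y) fun y' hy' => ?_
      rw [mul_assoc]
      refine hx _ ?_
      rw [pow_succ']
      exact Set.mul_mem_mul (Set.mem_insert_of_mem _ hy) hy'
    have hw := sum_mixture_weights i
    have e : f x - c = ∑ j ∈ Finset.range i, ((1 / 2 : ℝ) ^ (j + 1) : ℝ) • (Phi (ν j) f x - c)
        + (B x - B 1) := by
      simp only [smul_sub]
      rw [Finset.sum_sub_distrib, ← Finset.sum_smul, hw, hc, hsplit x, sub_smul, one_smul]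
      ring
    rw [e]
    -- The recursion `r ↦ s * r + (1 - s) * ε` fixes `ε` and contracts the excess by `s`.
    calc _ ≤ (∑ j ∈ Finset.range i, (1 / 2 : ℝ) ^ (j + 1) * r) + (1 / 2) ^ i * ε := by
          refine (norm_add_le _ _).trans (add_le_add ?_ (hB x hxK))
          refine norm_sum_le_of_le _ fun j hj => ?_
          rw [norm_smul, Real.norm_of_nonneg (by positivity)]
          gcongr
          exact hP j (Finset.mem_range.1 hj)
      _ = s ^ (n + 1) * (2 * ‖f‖) + ε := by
          rw [← Finset.sum_mul, hw, hr, hs]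
          ring

/-- From `1 - t ≤ exp (-t)` the term is at most `exp (-i)`; this dictates the exponent in `testSet`.
-/
theorem tendsto_one_sub_half_pow :
    Tendsto (fun i : ℕ => (1 - (1 / 2 : ℝ) ^ i) ^ (i * 2 ^ i)) atTop (𝓝 0) := by
  have h1 : ∀ i : ℕ, 0 ≤ 1 - (1 / 2 : ℝ) ^ i := fun i =>
    sub_nonneg.2 (pow_le_one₀ (by norm_num) (by norm_num))
  have h2 : Tendsto (fun i : ℕ => Real.exp (-(i : ℝ))) atTop (𝓝 0) :=
    Real.tendsto_exp_neg_atTop_nhds_zero.comp tendsto_natCast_atTop_atTop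
  refine squeeze_zero (fun i => pow_nonneg (h1 i) _) (fun i => ?_) h2
  have h3 : 1 - (1 / 2 : ℝ) ^ i ≤ Real.exp (-(1 / 2) ^ i) := Real.one_sub_le_exp_neg _
  refine (pow_le_pow_left₀ (h1 i) h3 _).trans (le_of_eq ?_)
  rw [← Real.exp_nat_mul]
  congr 1
  push_cast
  rw [mul_assoc, mul_neg, ← mul_pow]
  norm_num

/-- An amenable second-countable Hausdorff group carries a fully supported inner regular
probability measure all of whose harmonic functions are constant. -/
theorem IsAmenable.exists_liouville [T2Space G] [SecondCountableTopology G]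
    (hG : IsAmenable G) :
    ∃ (μ : Measure G) (_ : IsProbabilityMeasure μ), μ.support = Set.univ ∧ μ.InnerRegular ∧
      ∀ f ∈ harmonicSubmodule μ, ∀ x, f x = f 1 := by
  classical
  obtain ⟨ρ, hρ⟩ := exists_rightInvPseudoMetric G
  set z := TopologicalSpace.denseSeq G with hz
  obtain ⟨ν, T, hT, hprob, hsupp, hatom, hinv⟩ := hG.exists_measure_seq hρ z
  refine ⟨mixture ν, inferInstance, ?_, ?_, ?_⟩
  · refine Set.eq_univ_of_forall fun x => (Measure.mem_support_iff_forall x).2 fun U hU => ?_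
    obtain ⟨V, hVU, hV, hxV⟩ := mem_nhds_iff.1 hU
    obtain ⟨_, hy, i, rfl⟩ :=
      (TopologicalSpace.denseRange_denseSeq G).inter_open_nonempty V hV ⟨x, hxV⟩
    refine pos_iff_ne_zero.2 fun h0 => mixture_ne_zero i (hatom i) ?_
    exact measure_mono_null (Set.singleton_subset_iff.2 (hVU hy)) h0
  · refine innerRegular_of_countable (mixture ν) (S := ⋃ i, (T i : Set G))
      (Set.countable_iUnion fun i => (T i).countable_toSet) (ae_mixture_iff.2 fun i => ?_)
    filter_upwards [hsupp i (i + 1) i.lt_succ_self] with x hx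
    exact Set.mem_iUnion.2 ⟨i + 1, hx⟩
  · rintro f ⟨hf, hfh⟩
    have hpt : ∀ k, f (z k) = f 1 := fun k => by
      refine eq_of_forall_dist_le fun ε hε => ?_
      have hlim : Tendsto (fun i : ℕ => (1 - (1 / 2 : ℝ) ^ i) ^ (i * 2 ^ i) * (2 * ‖f‖))
          atTop (𝓝 0) := by
        simpa using tendsto_one_sub_half_pow.mul_const (2 * ‖f‖)
      -- Almost invariance is needed for all indices `≥ i`, because the whole tail of the mixture
      -- enters; `k ≤ i` puts `z k` in the test set.
      obtain ⟨i, hi1, hi2, hi3⟩ := ((hlim.eventually_le_const (show 0 < ε / 4 by positivity)).and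
        ((eventually_forall_ge_atTop.2 (eventually_almost_invariant hρ hinv hf
          (show 0 < ε / 4 by positivity))).and
            (eventually_ge_atTop k))).exists
      obtain ⟨c, hc⟩ := norm_sub_le_of_steps hfh (T := T i) (K := testSet z T i) (i := i)
        (ε := ε / 4) (fun j hj => hsupp j i hj)
        fun j hj g hg => hi2 j hj g (testSet_mono z hT hj hg)
      have key : ∀ x ∈ insert 1 ((Finset.range (i + 1)).image z), ‖f x - c‖ ≤ ε / 2 := by
        intro x hx
        have := hc (i * 2 ^ i) x fun y hy => by
          refine Finset.mem_coe.2 (Finset.mul_mem_mul hx ?_)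
          rw [← Finset.mem_coe]
          simpa using hy
        linarith
      have h1 := key 1 (Finset.mem_insert_self _ _)
      have h2 := key (z k) (Finset.mem_insert_of_mem
        (Finset.mem_image_of_mem _ (Finset.mem_range.2 (Nat.lt_succ_of_le hi3))))
      rw [dist_eq_norm, ← sub_sub_sub_cancel_right _ _ c]
      exact (norm_sub_le _ _).trans (by linarith)
    have := (TopologicalSpace.denseRange_denseSeq G).equalizer f.continuous
      (continuous_const (y := f 1)) (funext hpt)
    exact congrFun this

end Liouville

/-! ### Pointwise convergence of equicontinuous sequences. -/

section Equicontinuous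

variable {G : Type*} [Group G] [TopologicalSpace G] [IsTopologicalGroup G]

/-- An equicontinuous sequence converging on a dense set converges everywhere. -/
theorem tendsto_of_equicontinuous_of_dense {F : ℕ → G → ℂ} {F₀ : G → ℂ}
    (hF : ∀ ε : ℝ, 0 < ε → ∃ U ∈ 𝓝 (1 : G), ∀ n, ∀ x y : G, x * y⁻¹ ∈ U → ‖F n x - F n y‖ ≤ ε)
    (hF₀ : IsRightUnifCont F₀) {D : Set G} (hD : Dense D)
    (h : ∀ x ∈ D, Tendsto (fun n => F n x) atTop (𝓝 (F₀ x))) (x : G) :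
    Tendsto (fun n => F n x) atTop (𝓝 (F₀ x)) := by
  rw [Metric.tendsto_nhds]
  intro ε hε
  obtain ⟨U, hU, hFU⟩ := hF (ε / 4) (by positivity)
  obtain ⟨V, hV, hFV⟩ := hF₀ (ε / 4) (by positivity)
  have hc : Tendsto (fun y : G => x * y⁻¹) (𝓝 x) (𝓝 1) := by
    have : Continuous (fun y : G => x * y⁻¹) := by fun_prop
    simpa using this.tendsto x
  obtain ⟨y, hy, hyD⟩ := mem_closure_iff_nhds.1 (hD x) _ (hc (inter_mem hU hV))
  filter_upwards [Metric.tendsto_nhds.1 (h y hyD) (ε / 4) (by positivity)] with n hn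
  rw [dist_eq_norm] at hn ⊢
  have h1 := hFU n x y hy.1
  have h2 := hFV x y hy.2
  rw [show F n x - F₀ x = (F n x - F n y) + (F n y - F₀ y) - (F₀ x - F₀ y) by ring]
  refine (norm_sub_le _ _).trans_lt ?_
  have := norm_add_le (F n x - F n y) (F n y - F₀ y)
  linarith

end Equicontinuous

/-! ### Trivial boundary and constant harmonic functions. -/

section TrivialBoundary

variable {G : Type*} [Group G] [TopologicalSpace G] [IsTopologicalGroup G]
  [MeasurableSpace G] [BorelSpace G] [SecondCountableTopology G]
  {μ : Measure G} [IsProbabilityMeasure μ]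

/-- Nontriviality guarantees that the Gelfand spectrum is nonempty. -/
instance : Nontrivial (HarmonicFunction μ) :=
  ⟨0, 1, fun h => by
    have := congrArg (fun k : HarmonicFunction μ => k.toBCF 1) h
    simp at this⟩

/-- The Poisson boundary is trivial if and only if all harmonic functions are constant. -/
theorem nonempty_unique_poissonBoundary_iff :
    Nonempty (Unique (PoissonBoundary μ)) ↔ ∀ f ∈ harmonicSubmodule μ, ∀ x, f x = f 1 := by
  constructor
  · rintro ⟨hu⟩ f hf x
    let h : HarmonicFunction μ := ⟨f, hf⟩
    -- Both sides agree under the only character, and the Gelfand transform is injective.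
    have e : h = (default : PoissonBoundary μ) h • (1 : HarmonicFunction μ) := by
      apply (gelfandTransform_isometry (HarmonicFunction μ)).injective
      ext φ
      rw [Unique.eq_default φ, map_smul, map_one]
      simp
    have e' : ∀ y, f y = (default : PoissonBoundary μ) h := fun y => by
      have := congrArg (fun k : HarmonicFunction μ => k.toBCF y) e
      rw [HarmonicFunction.toBCF_smul] at this
      change h.toBCF y = _
      simpa using this
    rw [e' x, e' 1]
  · intro H
    have hs : Subsingleton (PoissonBoundary μ) := ⟨fun φ ψ => by
      ext h
      have e : h = h.toBCF 1 • (1 : HarmonicFunction μ) := HarmonicFunction.ext' fun g => by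
        simpa using H h.toBCF h.2 g
      rw [e, map_smul, map_smul, map_one φ, map_one ψ]⟩
    obtain ⟨φ⟩ : Nonempty (PoissonBoundary μ) := inferInstance
    exact ⟨⟨⟨φ⟩, fun ψ => Subsingleton.elim _ _⟩⟩

end TrivialBoundary

/-! ### Cesàro limits and amenability. -/

section Cesaro

variable {G : Type*} [Group G] [TopologicalSpace G] [IsTopologicalGroup G]
  [MeasurableSpace G] [BorelSpace G] [SecondCountableTopology G]

/-- An ultrafilter limit of an equicontinuous sequence of asymptotically harmonic functions
is harmonic. -/
theorem Phi_eq_of_ultrafilter_tendsto (μ : Measure G) [IsProbabilityMeasure μ] {F : ℕ → G → ℂ}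
    {F₀ : G → ℂ} {C : ℝ} (hC : ∀ n x, ‖F n x‖ ≤ C)
    (hF : ∀ ε : ℝ, 0 < ε → ∃ U ∈ 𝓝 (1 : G), ∀ n, ∀ x y : G, x * y⁻¹ ∈ U → ‖F n x - F n y‖ ≤ ε)
    {u : Ultrafilter ℕ} (hu : (u : Filter ℕ) ≤ atTop)
    (hlim : ∀ x, Tendsto (fun n => F n x) u (𝓝 (F₀ x)))
    (hΦ : ∀ x, Tendsto (fun n => Phi μ (F n) x - F n x) atTop (𝓝 0)) :
    IsRightUnifCont F₀ ∧ Phi μ F₀ = F₀ := by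
  have hF₀ : IsRightUnifCont F₀ := fun ε hε => by
    obtain ⟨U, hU, H⟩ := hF ε hε
    exact ⟨U, hU, fun x y hxy => le_of_tendsto ((hlim x).sub (hlim y)).norm
      (Eventually.of_forall fun n => H n x y hxy)⟩
  refine ⟨hF₀, funext fun g => ?_⟩
  let z := TopologicalSpace.denseSeq G
  have h1 : Tendsto (fun n k => F n (z k)) u (𝓝 fun k => F₀ (z k)) :=
    tendsto_pi_nhds.2 fun k => hlim (z k)
  -- Dominated convergence needs a sequence instead of an ultrafilter. On a countable dense set a
  -- subsequence has the same limit, and equicontinuity extends this to `G`.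
  obtain ⟨ψ, hψ, hψlim⟩ := (MapClusterPt.mono (h1.mapClusterPt) hu).tendsto_subseq
  have h2 : ∀ x, Tendsto (fun n => F (ψ n) x) atTop (𝓝 (F₀ x)) := by
    refine tendsto_of_equicontinuous_of_dense (fun ε hε => ?_) hF₀
      (TopologicalSpace.denseRange_denseSeq G) ?_
    · obtain ⟨U, hU, H⟩ := hF ε hε
      exact ⟨U, hU, fun n => H (ψ n)⟩
    · rintro _ ⟨k, rfl⟩
      exact tendsto_pi_nhds.1 hψlim k
  have hcont : ∀ n, Continuous (F n) := fun n => IsRightUnifCont.continuous fun ε hε => by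
    obtain ⟨U, hU, H⟩ := hF ε hε
    exact ⟨U, hU, H n⟩
  have h3 : Tendsto (fun n => Phi μ (F (ψ n)) g) atTop (𝓝 (Phi μ F₀ g)) :=
    tendsto_integral_of_dominated_convergence (fun _ => C)
      (fun n => ((hcont _).comp (continuous_const_mul g)).aestronglyMeasurable)
      (integrable_const _) (fun n => Eventually.of_forall fun x => hC _ _)
      (Eventually.of_forall fun x => h2 _)
  have h4 := ((hΦ g).comp hψ.tendsto_atTop)
  have h5 := h3.sub (h2 g)
  exact sub_eq_zero.1 (tendsto_nhds_unique h5 h4)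

/-- The Cesàro averages of `Φ_{μᵏ} f`. -/
noncomputable def cesaro (μ : Measure G) (n : ℕ) (f : G → ℂ) (g : G) : ℂ :=
  ((n : ℝ) + 1)⁻¹ • ∑ k ∈ Finset.range (n + 1), Phi (convPow μ k) f g

variable (μ : Measure G) [IsProbabilityMeasure μ]

theorem norm_average_le (n : ℕ) {v : ℕ → ℂ} {C : ℝ} (h : ∀ k, ‖v k‖ ≤ C) :
    ‖((n : ℝ) + 1)⁻¹ • ∑ k ∈ Finset.range (n + 1), v k‖ ≤ C := by
  have h1 := norm_sum_le_of_le (Finset.range (n + 1)) fun k _ => h k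
  rw [Finset.sum_const, Finset.card_range, nsmul_eq_mul] at h1
  rw [norm_smul, Real.norm_of_nonneg (by positivity), inv_mul_le_iff₀ (by positivity)]
  exact_mod_cast h1

theorem cesaro_norm_le (n : ℕ) (f : G →ᵇ ℂ) (g : G) : ‖cesaro μ n f g‖ ≤ ‖f‖ :=
  norm_average_le n fun _ => Phi_norm_le _ f.norm_coe_le_norm g

theorem cesaro_sub_le (n : ℕ) (f : G →ᵇ ℂ) {U : Set G} {ε : ℝ}
    (hU : ∀ x y : G, x * y⁻¹ ∈ U → ‖f x - f y‖ ≤ ε) (x y : G) (hxy : x * y⁻¹ ∈ U) :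
    ‖cesaro μ n f x - cesaro μ n f y‖ ≤ ε := by
  unfold cesaro
  rw [← smul_sub, ← Finset.sum_sub_distrib]
  exact norm_average_le n fun _ =>
    Phi_sub_le _ f.continuous f.norm_coe_le_norm hU x y hxy

/-- `Φ_μ` shifts the index of the average by one, so the difference telescopes. -/
theorem Phi_cesaro_sub (n : ℕ) {f : G →ᵇ ℂ} (hf : f ∈ RUCB G) (g : G) :
    Phi μ (cesaro μ n f) g - cesaro μ n f g
      = ((n : ℝ) + 1)⁻¹ • (Phi (convPow μ (n + 1)) f g - f g) := by
  have hi : ∀ k, Integrable (fun x => Phi (convPow μ k) f (g * x)) μ := fun k => by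
    have hc : Continuous (Phi (convPow μ k) f) := IsRightUnifCont.continuous fun ε hε => by
      obtain ⟨U, hU, H⟩ := hf ε hε
      exact ⟨U, hU, Phi_sub_le _ f.continuous f.norm_coe_le_norm H⟩
    exact Integrable.of_bound (hc.comp (continuous_const_mul g)).aestronglyMeasurable ‖f‖
      (Eventually.of_forall fun x => Phi_norm_le _ f.norm_coe_le_norm _)
  have h1 : Phi μ (cesaro μ n f) g
      = ((n : ℝ) + 1)⁻¹ • ∑ k ∈ Finset.range (n + 1), Phi (convPow μ (k + 1)) f g := by
    simp only [Phi_succ]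
    change ∫ x, ((n : ℝ) + 1)⁻¹ • ∑ k ∈ Finset.range (n + 1), Phi (convPow μ k) f (g * x) ∂μ = _
    rw [integral_smul, integral_finsetSum _ fun k _ => hi k]
    rfl
  rw [h1, cesaro, ← smul_sub, ← Finset.sum_sub_distrib,
    Finset.sum_range_sub (fun k => Phi (convPow μ k) f g), Phi_zero]

theorem tendsto_Phi_cesaro_sub {f : G →ᵇ ℂ} (hf : f ∈ RUCB G) (g : G) :
    Tendsto (fun n => Phi μ (cesaro μ n f) g - cesaro μ n f g) atTop (𝓝 0) := by
  have h1 : Tendsto (fun n : ℕ => ((n : ℝ) + 1)⁻¹ * (‖f‖ + ‖f‖)) atTop (𝓝 0) := by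
    simpa using (tendsto_one_div_add_atTop_nhds_zero_nat (𝕜 := ℝ)).mul_const (‖f‖ + ‖f‖)
  refine squeeze_zero_norm (fun n => ?_) h1
  rw [Phi_cesaro_sub μ n hf, norm_smul, Real.norm_of_nonneg (by positivity)]
  gcongr
  exact (norm_sub_le _ _).trans
    (add_le_add (Phi_norm_le _ f.norm_coe_le_norm g) (f.norm_coe_le_norm g))

/-- The value at the identity of the Cesàro averages, as a functional on `RUCB G`. -/
noncomputable def cesaroFunctional (n : ℕ) : RUCB G →L[ℂ] ℂ :=
  LinearMap.mkContinuous
    { toFun := fun f => cesaro μ n (f : G →ᵇ ℂ) 1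
      map_add' := fun f h => by
        change cesaro μ n ((f : G →ᵇ ℂ) + (h : G →ᵇ ℂ) : G →ᵇ ℂ) 1 = _
        simp only [cesaro, Phi_add, Finset.sum_add_distrib, smul_add]
      map_smul' := fun c f => by
        change cesaro μ n (c • (f : G →ᵇ ℂ) : G →ᵇ ℂ) 1 = _
        simp only [cesaro, Phi_smul, ← Finset.mul_sum, mul_smul_comm, RingHom.id_apply,
          smul_eq_mul] }
    1 fun f => by rw [one_mul]; exact cesaro_norm_le μ n f 1

theorem cesaroFunctional_apply (n : ℕ) (f : RUCB G) :
    cesaroFunctional μ n f = cesaro μ n (f : G →ᵇ ℂ) 1 := rfl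

/-- Translation moves the evaluation point from `1` to `g`: invariance of a limit functional becomes
constancy of a limit function. -/
theorem cesaroFunctional_leftTranslate (n : ℕ) (g : G) (f : RUCB G) :
    cesaroFunctional μ n (leftTranslate g f) = cesaro μ n (f : G →ᵇ ℂ) g := by
  simp [cesaroFunctional_apply, cesaro, Phi]

theorem cesaroFunctional_mem_states (n : ℕ) : cesaroFunctional μ n ∈ states G := by
  refine ⟨fun f hf => ?_, ?_⟩
  · have h1 : ∀ k, 0 ≤ Phi (convPow μ k) (f : G →ᵇ ℂ) 1 := fun k =>
      integral_nonneg fun x => hf _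
    exact smul_nonneg (show (0 : ℝ) ≤ ((n : ℝ) + 1)⁻¹ by positivity) (Finset.sum_nonneg fun k _ => h1 k)
  · have h1 : ∀ k, Phi (convPow μ k) ((1 : RUCB G) : G →ᵇ ℂ) 1 = 1 := fun k => by simp [Phi]
    rw [cesaroFunctional_apply, cesaro]
    simp only [h1, Finset.sum_const, Finset.card_range, nsmul_eq_mul, mul_one]
    rw [Complex.real_smul]
    push_cast
    exact inv_mul_cancel₀ (by exact_mod_cast n.succ_ne_zero)

/-- Banach-Alaoglu in the dual unit ball; positivity and normalization survive weak-* limits. -/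
theorem exists_ultrafilter_limit (u : Ultrafilter ℕ) :
    ∃ m ∈ states G, ∀ f, Tendsto (fun n => cesaroFunctional μ n f) u (𝓝 (m f)) := by
  have hk := WeakDual.isCompact_closedBall (𝕜 := ℂ) (0 : StrongDual ℂ (RUCB G)) 1
  obtain ⟨m, -, hm⟩ := hk.ultrafilter_le_nhds
    (u.map fun n => StrongDual.toWeakDual (cesaroFunctional μ n)) (by
      refine le_principal_iff.2 (Ultrafilter.mem_map.2 (univ_mem' fun n => ?_))
      have h : ‖cesaroFunctional μ n‖ ≤ 1 := LinearMap.mkContinuous_norm_le _ zero_le_one _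
      simpa using h)
  have hlim : ∀ f, Tendsto (fun n => cesaroFunctional μ n f) u
      (𝓝 (WeakDual.toStrongDual m f)) := fun f =>
    ((WeakDual.eval_continuous f).tendsto m).comp (show Tendsto _ (u : Filter ℕ) _ from hm)
  refine ⟨WeakDual.toStrongDual m, ⟨fun f hf => ?_, ?_⟩, hlim⟩
  · exact ge_of_tendsto (hlim f)
      (Eventually.of_forall fun n => (cesaroFunctional_mem_states μ n).1 f hf)
  · refine tendsto_nhds_unique (hlim 1) ?_
    simp only [(cesaroFunctional_mem_states μ _).2]
    exact tendsto_const_nhds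

/-- A topological group carrying a measure all of whose harmonic functions are constant is
amenable. -/
theorem isAmenable_of_liouville (H : ∀ f ∈ harmonicSubmodule μ, ∀ x, f x = f 1) :
    IsAmenable G := by
  obtain ⟨m, hm, hlim⟩ := exists_ultrafilter_limit μ (hyperfilter ℕ)
  refine ⟨m, hm, fun g f => ?_⟩
  have hlim' : ∀ x, Tendsto (fun n => cesaro μ n (f : G →ᵇ ℂ) x) (hyperfilter ℕ : Filter ℕ)
      (𝓝 (m (leftTranslate x f))) := fun x => by
    simpa only [cesaroFunctional_leftTranslate] using hlim (leftTranslate x f)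
  obtain ⟨h1, h2⟩ := Phi_eq_of_ultrafilter_tendsto μ (cesaro_norm_le μ · (f : G →ᵇ ℂ))
    (fun ε hε => by
      obtain ⟨U, hU, hfU⟩ := f.2 ε hε
      exact ⟨U, hU, fun n => cesaro_sub_le μ n f hfU⟩)
    Nat.hyperfilter_le_atTop hlim' (tendsto_Phi_cesaro_sub μ f.2)
  -- The hypothesis is applied to the harmonic function `x ↦ m (f ∘ λ_x)`, compared at `g` and `1`.
  have h3 := H (BoundedContinuousFunction.ofNormedAddCommGroup _ h1.continuous ‖(f : G →ᵇ ℂ)‖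
    fun x => le_of_tendsto (hlim' x).norm
      (Eventually.of_forall fun n => cesaro_norm_le μ n f x)) ⟨h1, h2⟩ g
  have h4 : leftTranslate 1 f = f := by
    ext x
    simp
  change m (leftTranslate g f) = m (leftTranslate 1 f) at h3
  rw [h3, h4]

end Cesaro

end TopFurstenberg

/-! ### The equivalence. -/

theorem corollary4p7 (G : Type*) [Group G] [TopologicalSpace G] [IsTopologicalGroup G]
    [T2Space G] [SecondCountableTopology G] [MeasurableSpace G] [BorelSpace G] :
    List.TFAE
      [TopFurstenberg.IsAmenable G,
       ∃ (μ : Measure G) (_ : IsProbabilityMeasure μ),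
         μ.support = Set.univ ∧ μ.InnerRegular ∧
           Nonempty (Unique (TopFurstenberg.PoissonBoundary μ)),
       ∃ (μ : Measure G) (_ : IsProbabilityMeasure μ),
         Nonempty (Unique (TopFurstenberg.PoissonBoundary μ))] := by
  tfae_have 1 → 2 := fun hG => by
    obtain ⟨μ, hμ, h1, h2, h3⟩ := hG.exists_liouville
    exact ⟨μ, hμ, h1, h2, TopFurstenberg.nonempty_unique_poissonBoundary_iff.2 h3⟩
  tfae_have 2 → 3 := fun ⟨μ, hμ, _, _, h⟩ => ⟨μ, hμ, h⟩
  tfae_have 3 → 1 := fun ⟨μ, _, h⟩ =>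
    TopFurstenberg.isAmenable_of_liouville μ
      (TopFurstenberg.nonempty_unique_poissonBoundary_iff.1 h)
  tfae_finish
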